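/- **Setting.** Let $\mathcal X\subset\mathbb R^n$ and $\mathcal Y\subset\mathbb R^m$ be closed and convex, $(\Omega,\mathcal F,P)$ a probability space, $\mathcal A$ a set of $\mathcal X$-valued random variables on $\Omega$, $\mathcal A_\mu\subset\mathcal P(\mathcal X)$ the set of laws of the elements of $\mathcal A$, and $\nu_0\in\mathcal P(\mathcal Y)$. Let $\varphi:[0,\infty)\to[0,\infty]$ be an entropy function, i.e. convex, lower semicontinuous and finite at some point of $(0,\infty)$; put $\varphi'_\infty=\lim_{s\to\infty}\varphi(s)/s$ and $D_\varphi(\mu,\nu)=\int\varphi\big(\tfrac{d\mu}{d\nu}\big)\,d\nu+\varphi'_\infty\,\mu^\perp(\mathcal Y)$, where $\mu=\tfrac{d\mu}{d\nu}\nu+\mu^\perp$ is the Lebesgue decomposition and $0\cdot\infty=0$ in this formula. For $\gamma\in\mathcal P(\mathcal X\times\mathcal Y)$ with marginals $\pi_1\gamma,\pi_2\gamma$ let $\mathcal R_2(\gamma)=D_\varphi(\pi_2\gamma,\nu_0)$, and put $\Gamma_\mu=\{\gamma:\pi_1\gamma=\mu\}$, $\Gamma(\mu,\eta)=\{\gamma\in\Gamma_\mu:\mathcal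 R_2(\gamma)\le\eta\}$. For $U:\mathcal X\times\mathcal Y\to\mathbb R$ and $\eta,\theta\ge 0$ define, in $[-\infty,\infty]$, $$J^{c,d}(\eta)=\sup_{\mu\in\mathcal A_\mu}\ \inf_{\gamma\in\Gamma(\mu,\eta)}\int U\,d\gamma,\qquad J^{p,d}(\theta)=\sup_{\mu\in\mathcal A_\mu}\ \inf_{\gamma\in\Gamma_\mu}\Big\{\int U\,d\gamma+\theta\,\mathcal R_2(\gamma)\Big\},$$ where the penalized objective is $+\infty$ if $\mathcal R_2(\gamma)=\infty$ (also when $\theta=0$). An optimizer of either problem is a pair $(\mu^*,\gamma^*)$ with $\mu^*\in\mathcal A_\mu$ such that $\mu^*$ attains the outer supremum and $\gamma^*$ is admissible and attains the inner infimum at $\mu^*$. At a $\theta\ge0$ where $J^{p,d}(\theta)$ is finite, $\partial J^{p,d}(\theta)$ is the set of $\eta\in\mathbb R$ with $J^{p,d}(t)-J^{p,d}(\theta)\le\eta(t-\theta)$ for all $t\ge0$; otherwise it is empty. **Assumptions.** $U$ is continuous and bounded, and concave in $x$ for each fixed $y$; $\mathcal A$ is convex and every sequence in $\mathcal A_\mu$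 has a subsequence that converges weakly to an element of $\mathcal A_\mu$; either $\varphi'_\infty=\infty$, or $\{(x,y)\in\mathcal X\times\mathcal Y:U(x,y)\le\alpha\}$ is compact for every $\alpha\in\mathbb R$; there is a metric on $\mathcal P(\mathcal X\times\mathcal Y)$ for which $\Gamma_\mu$ is compact for every $\mu\in\mathcal A_\mu$. **Theorem (Dual relation).** (1) Let $\eta>\varphi(1)$ (that is, $\eta>0$ when $\varphi(1)=0$), and suppose that $(\mu^*,\gamma^*)$ is an optimizer of $J^{c,d}(\eta)$. Then there is $\theta=\theta(\eta,\mu^*)\ge0$, not depending on $\gamma^*$, such that $(\mu^*,\gamma^*)$ is also an optimizer of $J^{p,d}(\theta)$, and $\theta$ attains the maximum in $$J^{c,d}(\eta)=\max_{t\ge0}\{J^{p,d}(t)-t\eta\}.$$ (2) Conversely, let $\theta\in(0,\infty)$. If $J^{p,d}(\theta)$ admits an optimizer, then for every $\eta\in\partial J^{p,d}(\theta)$ there is an optimizer $(\mu^*,\gamma^*)$ of $J^{p,d}(\theta)$ that is also an optimizer of $J^{c,d}(\eta)$ and satisfies $\eta=\mathcal R_2(\gamma^*)$. In addition, every $\eta\in\partial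 J^{p,d}(\theta)$ attains the minimum in $$J^{p,d}(\theta)=\min_{e\ge0}\{J^{c,d}(e)+\theta e\}.$$ -/

import Mathlib

open MeasureTheory
open scoped NNReal ENNReal

noncomputable section

namespace RDRO

/-- Entropy functions `φ : [0, ∞) → [0, ∞]`: convex, lower semicontinuous, and finite at some
point of `(0, ∞)`. -/
structure IsEntropyFunction (φ : ℝ≥0 → ℝ≥0∞) : Prop where
  convex : ConvexOn ℝ≥0 Set.univ φ
  lowerSemicontinuous : LowerSemicontinuous φ
  exists_finite : ∃ s : ℝ≥0, 0 < s ∧ φ s ≠ ∞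

/-- The growth rate `φ'_∞ = lim_{s → ∞} φ(s) / s`. The limit exists in `[0, ∞]` for every entropy
function, so that it is the upper limit written here. -/
def growthRate (φ : ℝ≥0 → ℝ≥0∞) : ℝ≥0∞ :=
  Filter.limsup (fun s : ℝ≥0 => φ s / (s : ℝ≥0∞)) Filter.atTop

/-- The `φ`-divergence `D_φ(μ, ν) = ∫ φ(dμ/dν) dν + φ'_∞ μ^⊥(univ)`, for the Lebesgue
decomposition `μ = (dμ/dν) ν + μ^⊥`. In `[0, ∞]` one has `0 * ∞ = 0`. -/
def phiDivergence {β : Type*} [MeasurableSpace β] (φ : ℝ≥0 → ℝ≥0∞) (μ ν : Measure β) : ℝ≥0∞ :=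
  ∫⁻ y, φ (μ.rnDeriv ν y).toNNReal ∂ν + growthRate φ * μ.singularPart ν Set.univ

/-- The set `𝒜_μ` of the laws of the decisions `X ∈ 𝒜`. -/
def decisionLaws {Ω α : Type*} [MeasurableSpace Ω] [MeasurableSpace α]
    (P : Measure Ω) (A : Set (Ω → α)) : Set (ProbabilityMeasure α) :=
  {μ | ∃ X ∈ A, (μ : Measure α) = P.map X}

/-- Convexity of a set of random variables with values in a subset of a vector space, under
pointwise convex combinations. -/
def ConvexDecisions {Ω E : Type*} [AddCommGroup E] [Module ℝ E] {𝒳 : Set E}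
    (A : Set (Ω → 𝒳)) : Prop :=
  Convex ℝ ((fun (X : Ω → 𝒳) (ω : Ω) => (X ω : E)) '' A)

/-- Concavity of `U(x, y)` in `x ∈ 𝒳` for every fixed `y` (with `𝒳` a convex set). -/
def ConcaveInFst {E β : Type*} [AddCommGroup E] [Module ℝ E] {𝒳 : Set E}
    (U : 𝒳 × β → ℝ) : Prop :=
  ∀ (y : β) (x₁ x₂ x : 𝒳) (a b : ℝ), 0 ≤ a → 0 ≤ b → a + b = 1 →
    (x : E) = a • (x₁ : E) + b • (x₂ : E) → a * U (x₁, y) + b * U (x₂, y) ≤ U (x, y)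

section Problems

variable {α β : Type*} [MeasurableSpace α] [MeasurableSpace β]

/-- `Γ_μ`: the joint laws with first marginal `μ`. -/
def couplings (β : Type*) [MeasurableSpace β] (μ : ProbabilityMeasure α) :
    Set (ProbabilityMeasure (α × β)) :=
  {γ | (γ : Measure (α × β)).fst = μ}

/-- `R₂(γ) = D_φ(π₂ γ, ν₀)`. -/
def marginalDivergence (φ : ℝ≥0 → ℝ≥0∞) (ν₀ : ProbabilityMeasure β)
    (γ : ProbabilityMeasure (α × β)) : ℝ≥0∞ :=
  phiDivergence φ (γ : Measure (α × β)).snd ν₀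

/-- `Γ(μ, η)`: the joint laws with first marginal `μ` and `R₂(γ) ≤ η`. -/
def constrainedCouplings (φ : ℝ≥0 → ℝ≥0∞) (ν₀ : ProbabilityMeasure β)
    (μ : ProbabilityMeasure α) (η : ℝ) : Set (ProbabilityMeasure (α × β)) :=
  {γ | γ ∈ couplings β μ ∧ marginalDivergence φ ν₀ γ ≤ ENNReal.ofReal η}

/-- `inf_{γ ∈ Γ(μ, η)} ∫ U dγ`. -/
def constrainedInner (U : α × β → ℝ) (φ : ℝ≥0 → ℝ≥0∞) (ν₀ : ProbabilityMeasure β)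
    (η : ℝ) (μ : ProbabilityMeasure α) : EReal :=
  ⨅ γ ∈ constrainedCouplings φ ν₀ μ η, ((∫ p, U p ∂(γ : Measure (α × β)) : ℝ) : EReal)

/-- The value `J^{c,d}(η) = sup_{μ ∈ 𝒜_μ} inf_{γ ∈ Γ(μ, η)} ∫ U dγ`. -/
def constrainedValue (U : α × β → ℝ) (φ : ℝ≥0 → ℝ≥0∞) (ν₀ : ProbabilityMeasure β)
    (Aμ : Set (ProbabilityMeasure α)) (η : ℝ) : EReal :=
  ⨆ μ ∈ Aμ, constrainedInner U φ ν₀ η μ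

/-- `(μ, γ)` is an optimizer of `J^{c,d}(η)`: `μ` attains the outer supremum and `γ` attains the
inner infimum at `μ`. -/
def IsConstrainedOptimizer (U : α × β → ℝ) (φ : ℝ≥0 → ℝ≥0∞) (ν₀ : ProbabilityMeasure β)
    (Aμ : Set (ProbabilityMeasure α)) (η : ℝ)
    (μ : ProbabilityMeasure α) (γ : ProbabilityMeasure (α × β)) : Prop :=
  μ ∈ Aμ ∧ γ ∈ constrainedCouplings φ ν₀ μ η ∧
    ((∫ p, U p ∂(γ : Measure (α × β)) : ℝ) : EReal) = constrainedInner U φ ν₀ η μ ∧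
    constrainedInner U φ ν₀ η μ = constrainedValue U φ ν₀ Aμ η

open Classical in
/-- The penalized objective `J^{p,d}(θ, μ, γ) = ∫ U dγ + θ R₂(γ)`, with value `+∞` when
`R₂(γ) = ∞`. For `θ > 0` this is the plain extended-real expression; for `θ = 0` it says that
the infimum is over the effective domain of `R₂`, as usual for Lagrangians in convex analysis. -/
def penalizedObjective (U : α × β → ℝ) (φ : ℝ≥0 → ℝ≥0∞) (ν₀ : ProbabilityMeasure β)
    (θ : ℝ) (γ : ProbabilityMeasure (α × β)) : EReal :=
  if marginalDivergence φ ν₀ γ = ∞ then ⊤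
  else ((∫ p, U p ∂(γ : Measure (α × β)) + θ * (marginalDivergence φ ν₀ γ).toReal : ℝ) : EReal)

/-- `J^{p,d}(θ, μ) = inf_{γ ∈ Γ_μ} J^{p,d}(θ, μ, γ)`. -/
def penalizedInner (U : α × β → ℝ) (φ : ℝ≥0 → ℝ≥0∞) (ν₀ : ProbabilityMeasure β)
    (θ : ℝ) (μ : ProbabilityMeasure α) : EReal :=
  ⨅ γ ∈ couplings β μ, penalizedObjective U φ ν₀ θ γ

/-- The value `J^{p,d}(θ) = sup_{μ ∈ 𝒜_μ} inf_{γ ∈ Γ_μ} { ∫ U dγ + θ R₂(γ) }`. -/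
def penalizedValue (U : α × β → ℝ) (φ : ℝ≥0 → ℝ≥0∞) (ν₀ : ProbabilityMeasure β)
    (Aμ : Set (ProbabilityMeasure α)) (θ : ℝ) : EReal :=
  ⨆ μ ∈ Aμ, penalizedInner U φ ν₀ θ μ

/-- `(μ, γ)` is an optimizer of `J^{p,d}(θ)`: `μ` attains the outer supremum and `γ` attains the
inner infimum at `μ`. -/
def IsPenalizedOptimizer (U : α × β → ℝ) (φ : ℝ≥0 → ℝ≥0∞) (ν₀ : ProbabilityMeasure β)
    (Aμ : Set (ProbabilityMeasure α)) (θ : ℝ)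
    (μ : ProbabilityMeasure α) (γ : ProbabilityMeasure (α × β)) : Prop :=
  μ ∈ Aμ ∧ γ ∈ couplings β μ ∧
    penalizedObjective U φ ν₀ θ γ = penalizedInner U φ ν₀ θ μ ∧
    penalizedInner U φ ν₀ θ μ = penalizedValue U φ ν₀ Aμ θ

end Problems

/-- The superdifferential at `θ` of a function `g` on `[0, ∞)`, at points where `g` is finite:
all `η` with `g(t) - g(θ) ≤ η (t - θ)` for every `t ≥ 0`. -/
def superdifferential (g : ℝ → EReal) (θ : ℝ) : Set ℝ :=
  {η | g θ ≠ ⊤ ∧ g θ ≠ ⊥ ∧ ∀ t : ℝ, 0 ≤ t → g t ≤ g θ + ((η * (t - θ) : ℝ) : EReal)}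

end RDRO

end

/-! Fix a law `μ` and let `W` be the planar set `attainableBounds` of pairs (cost bound, divergence
bound) met by some coupling with first marginal `μ`. The constrained inner value is the lowest cost
in `W` at height `η`; the penalized one is the infimum of `z.1 + θ * z.2` over `W`. Weak duality is
immediate, and the rest is convex geometry of `W`, one `μ` at a time: no interchange of supremum and
infimum over laws is needed.

From constrained to penalized: `W` is convex and the product coupling is a Slater point, so a line
of slope `-θ` supports `W` at height `η` for the optimal `μ`. Weak duality then squeezes the
penalized value onto the constrained value plus `θ * η`.

From penalized to constrained: let `p` be the penalized value at `θ` and `η` a supergradient. If `(p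
- θ * η, η)` were outside `W` for some `μ`, a separating line with multiplier `t` would lift the
penalized value at `t` above its supporting line. So this point lies in every `W`, which gives
strong duality; at an optimal `μ` the coupling realizing it is optimal for both problems, and `θ >
0` forces its divergence to equal `η`.

The separation needs `W` closed. For this the divergence is written as a supremum of integrals of
affine minorants of `φ`, and these are made continuous, which gives convexity, weak lower
semicontinuity and tightness of sublevel sets; Prokhorov's theorem does the rest. -/

namespace RDRO

open Filter Topology Set

/-! ### Affine minorants of an entropy function -/

/-- The affine functions `s ↦ a s + b`, encoded as pairs `(a, b)`, that lie below `φ`. -/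
def affineMinorants (φ : ℝ≥0 → ℝ≥0∞) : Set (ℝ × ℝ) :=
  {v | ∀ s : ℝ≥0, ENNReal.ofReal (v.1 * s + v.2) ≤ φ s}

theorem zero_mem_affineMinorants (φ : ℝ≥0 → ℝ≥0∞) : (0 : ℝ × ℝ) ∈ affineMinorants φ := by
  intro s; simp

theorem convex_affineMinorants (φ : ℝ≥0 → ℝ≥0∞) : Convex ℝ (affineMinorants φ) := by
  intro v hv w hw a b ha hb hab s
  rcases eq_or_ne (φ s) ∞ with h | h
  · simp [h]
  have h1 := (ENNReal.ofReal_le_iff_le_toReal h).1 (hv s)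
  have h2 := (ENNReal.ofReal_le_iff_le_toReal h).1 (hw s)
  refine (ENNReal.ofReal_le_iff_le_toReal h).2 ?_
  have : (a • v + b • w).1 * s + (a • v + b • w).2
      = a * (v.1 * s + v.2) + b * (w.1 * s + w.2) := by
    simp; ring
  rw [this]
  calc _ ≤ a * (φ s).toReal + b * (φ s).toReal := by gcongr
    _ = (φ s).toReal := by rw [← add_mul, hab, one_mul]

theorem clm_prod_apply (f : ℝ × ℝ →L[ℝ] ℝ) (z : ℝ × ℝ) :
    f z = f (1, 0) * z.1 + f (0, 1) * z.2 := by
  have : z = z.1 • ((1, 0) : ℝ × ℝ) + z.2 • ((0, 1) : ℝ × ℝ) := by ext <;> simp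
  conv_lhs => rw [this]
  simp only [map_add, map_smul, smul_eq_mul]
  ring

/-- The point `(s, c)` lies outside the closed convex epigraph of `φ`, and a line separating the two
gives the minorant. -/
theorem IsEntropyFunction.exists_affineMinorant_gt {φ : ℝ≥0 → ℝ≥0∞} (hφ : IsEntropyFunction φ)
    {s : ℝ≥0} {c : ℝ} (h : ENNReal.ofReal c < φ s) :
    ∃ v ∈ affineMinorants φ, c < v.1 * s + v.2 := by
  set E : Set (ℝ × ℝ) :=
    {z | 0 ≤ z.1 ∧ 0 ≤ z.2 ∧ φ z.1.toNNReal ≤ ENNReal.ofReal z.2} with hE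
  have hconv : Convex ℝ E := by
    rintro z ⟨hz1, hz2, hz⟩ w ⟨hw1, hw2, hw⟩ a b ha hb hab
    refine ⟨by simp; positivity, by simp; positivity, ?_⟩
    have key := hφ.convex.2 (mem_univ z.1.toNNReal) (mem_univ w.1.toNNReal)
      (zero_le : 0 ≤ a.toNNReal) (zero_le : 0 ≤ b.toNNReal)
      (by rw [← Real.toNNReal_add ha hb, hab, Real.toNNReal_one])
    have e1 : a.toNNReal • z.1.toNNReal + b.toNNReal • w.1.toNNReal
        = (a • z + b • w).1.toNNReal := by
      simp only [Prod.fst_add, Prod.smul_fst, smul_eq_mul]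
      rw [Real.toNNReal_add (by positivity) (by positivity), Real.toNNReal_mul ha,
        Real.toNNReal_mul hb]
    rw [e1] at key
    refine key.trans ?_
    simp only [Prod.snd_add, Prod.smul_snd, smul_eq_mul]
    rw [ENNReal.ofReal_add (by positivity) (by positivity), ENNReal.ofReal_mul ha,
      ENNReal.ofReal_mul hb]
    simp only [ENNReal.smul_def, smul_eq_mul]
    change ENNReal.ofReal a * _ + ENNReal.ofReal b * _ ≤ _
    gcongr
  have hclosed : IsClosed E := by
    refine (isClosed_le continuous_const continuous_fst).inter
      ((isClosed_le continuous_const continuous_snd).inter ?_)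
    exact hφ.lowerSemicontinuous.isClosed_epigraph.preimage
      (f := fun z : ℝ × ℝ => (z.1.toNNReal, ENNReal.ofReal z.2))
      ((continuous_real_toNNReal.comp continuous_fst).prodMk
        (ENNReal.continuous_ofReal.comp continuous_snd))
  have hnot : ((s : ℝ), c) ∉ E := by
    rintro ⟨-, -, h3⟩
    simp only [Real.toNNReal_coe] at h3
    exact absurd h3 (not_le.2 h)
  obtain ⟨f, u, hfx, hf⟩ := geometric_hahn_banach_point_closed hconv hclosed hnot
  set α := f (1, 0)
  set β := f (0, 1)
  have hfx' : α * s + β * c < u := by rwa [clm_prod_apply f] at hfx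
  have hf' : ∀ t : ℝ≥0, ∀ r : ℝ, 0 ≤ r → φ t ≤ ENNReal.ofReal r → u < α * t + β * r := by
    intro t r hr htr
    have := hf ((t : ℝ), r) ⟨t.2, hr, by simpa using htr⟩
    rwa [clm_prod_apply f] at this
  have hfin : ∀ t : ℝ≥0, φ t ≠ ∞ → u < α * t + β * (φ t).toReal := fun t ht =>
    hf' t _ ENNReal.toReal_nonneg (ENNReal.ofReal_toReal ht).ge
  obtain ⟨s₁, -, hs₁⟩ := hφ.exists_finite
  have hβ : 0 ≤ β := by
    by_contra! hneg
    obtain ⟨n, hn⟩ := exists_nat_gt ((α * s₁ + β * (φ s₁).toReal - u) / (-β))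
    have h1 := hf' s₁ ((φ s₁).toReal + n) (by positivity) (by
      rw [← ENNReal.ofReal_toReal hs₁]
      exact ENNReal.ofReal_le_ofReal (by simp))
    rw [div_lt_iff₀ (by linarith)] at hn
    nlinarith
  rcases hβ.eq_or_lt with hβ0 | hβ0
  -- Vertical separating line: `k * (u - α * t)` is negative wherever `φ` is finite, and exceeds `c`
  -- at `s` once `k` is large.
  · rw [← hβ0] at hfx' hfin
    obtain ⟨k, hk⟩ := exists_nat_gt (c / (u - α * s))
    rw [div_lt_iff₀ (by linarith)] at hk
    refine ⟨(-(k * α), k * u), fun t => ?_, by simp only; nlinarith⟩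
    rcases eq_or_ne (φ t) ∞ with ht | ht
    · simp [ht]
    have := hfin t ht
    rw [ENNReal.ofReal_of_nonpos]
    · exact zero_le
    · simp only
      have hk0 : (0 : ℝ) ≤ k := by positivity
      nlinarith
  · refine ⟨(-(α / β), u / β), fun t => ?_, ?_⟩
    · rcases eq_or_ne (φ t) ∞ with ht | ht
      · simp [ht]
      have := hfin t ht
      refine (ENNReal.ofReal_le_iff_le_toReal ht).2 ?_
      have h2 : -(α / β) * t + u / β = (u - α * t) / β := by ring
      rw [h2, div_le_iff₀ hβ0]
      linarith
    · have h2 : -(α / β) * s + u / β = (u - α * s) / β := by ring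
      rw [h2, lt_div_iff₀ hβ0]
      linarith

theorem fst_le_growthRate {φ : ℝ≥0 → ℝ≥0∞} {v : ℝ × ℝ} (hv : v ∈ affineMinorants φ) :
    ENNReal.ofReal v.1 ≤ growthRate φ := by
  have hlim : Tendsto (fun s : ℝ≥0 => ENNReal.ofReal (v.1 + v.2 / s)) atTop
      (𝓝 (ENNReal.ofReal v.1)) := by
    refine ENNReal.tendsto_ofReal ?_
    have h1 : Tendsto (fun s : ℝ≥0 => v.2 / (s : ℝ)) atTop (𝓝 0) :=
      tendsto_const_nhds.div_atTop (NNReal.tendsto_coe_atTop.2 tendsto_id)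
    simpa using h1.const_add v.1
  rw [← hlim.limsup_eq]
  refine limsup_le_limsup ?_
  filter_upwards [eventually_gt_atTop 0] with s hs
  have hs' : (0 : ℝ) < s := hs
  rw [ENNReal.le_div_iff_mul_le (by simp [hs.ne']) (by simp)]
  refine le_trans (le_of_eq ?_) (hv s)
  rw [← ENNReal.ofReal_coe_nnreal (p := s), ← ENNReal.ofReal_mul' hs'.le]
  congr 1
  field_simp

/-- A minorant that exceeds `d' * s` at a far point `s` but stays below `φ s₁` at a fixed `s₁` must
have slope above any `c < d'`. -/
theorem IsEntropyFunction.exists_affineMinorant_fst_gt {φ : ℝ≥0 → ℝ≥0∞}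
    (hφ : IsEntropyFunction φ) {c : ℝ} (hc : 0 ≤ c) (h : ENNReal.ofReal c < growthRate φ) :
    ∃ v ∈ affineMinorants φ, c < v.1 := by
  obtain ⟨d, hd1, hd2⟩ := exists_between h
  have hdt : d ≠ ∞ := hd2.ne_top
  set d' := d.toReal with hd'
  have hcd : c < d' := (ENNReal.ofReal_lt_iff_lt_toReal hc hdt).1 hd1
  obtain ⟨s₁, -, hs₁⟩ := hφ.exists_finite
  have hfreq : ∃ᶠ s : ℝ≥0 in atTop, d < φ s / s := frequently_lt_of_lt_limsup (by isBoundedDefault) hd2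
  -- Beyond `N`, the rise `d' * s - φ s₁` exceeds `c * (s - s₁)`.
  obtain ⟨N, hN⟩ := exists_nat_gt (max (((φ s₁).toReal - c * s₁) / (d' - c)) 0 + s₁)
  obtain ⟨s, hs, hsN⟩ := (hfreq.and_eventually
    (eventually_ge_atTop ((max N 1 : ℕ) : ℝ≥0))).exists
  have hs1 : (1 : ℝ≥0) ≤ s := le_trans (by norm_cast; exact le_max_right _ _) hsN
  have hsN' : (N : ℝ) ≤ s := by
    have : (N : ℝ≥0) ≤ s := le_trans (by norm_cast; exact le_max_left _ _) hsN
    exact_mod_cast this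
  have hs0 : (0 : ℝ) < s := lt_of_lt_of_le zero_lt_one (by exact_mod_cast hs1)
  have hds : ENNReal.ofReal (d' * s) < φ s := by
    rw [ENNReal.lt_div_iff_mul_lt (by left; simp; rintro rfl; simp at hs0) (by simp)] at hs
    rwa [ENNReal.ofReal_mul ENNReal.toReal_nonneg, ENNReal.ofReal_toReal hdt,
      ENNReal.ofReal_coe_nnreal]
  obtain ⟨v, hv, hvs⟩ := hφ.exists_affineMinorant_gt hds
  refine ⟨v, hv, ?_⟩
  have h1 := (ENNReal.ofReal_le_iff_le_toReal hs₁).1 (hv s₁)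
  have h2 : ((φ s₁).toReal - c * s₁) / (d' - c) < s - s₁ := by
    linarith [le_max_left (((φ s₁).toReal - c * s₁) / (d' - c)) 0]
  rw [div_lt_iff₀ (by linarith)] at h2
  have hss : (s₁ : ℝ) < s := by
    linarith [le_max_right (((φ s₁).toReal - c * s₁) / (d' - c)) 0]
  by_contra! hvc
  nlinarith

/-! ### Dual representation of the divergence -/

section Duality

variable {β : Type*} [MeasurableSpace β]

theorem ofReal_integral_le_lintegral (μ : Measure β) {f : β → ℝ} (hf : Integrable f μ) :
    ENNReal.ofReal (∫ y, f y ∂μ) ≤ ∫⁻ y, ENNReal.ofReal (f y) ∂μ := by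
  rw [integral_eq_lintegral_pos_part_sub_lintegral_neg_part hf]
  refine (ENNReal.ofReal_le_ofReal (sub_le_self _ ENNReal.toReal_nonneg)).trans ?_
  exact ENNReal.ofReal_toReal_le

theorem integrable_of_norm_le (μ : Measure β) [IsFiniteMeasure μ] {f : β → ℝ}
    (hf : Measurable f) {M : ℝ} (hM : ∀ y, ‖f y‖ ≤ M) : Integrable f μ :=
  Integrable.of_bound hf.aestronglyMeasurable M (ae_of_all _ hM)

theorem integrable_mul_rnDeriv (ρ ν : Measure β) [IsFiniteMeasure ρ] {a : β → ℝ}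
    (ha : Measurable a) {M : ℝ} (hM : ∀ y, ‖a y‖ ≤ M) :
    Integrable (fun y => a y * (ρ.rnDeriv ν y).toReal) ν :=
  Measure.integrable_toReal_rnDeriv.bdd_mul (c := M) ha.aestronglyMeasurable (ae_of_all _ hM)

theorem integral_eq_rnDeriv_add_singularPart (ρ ν : Measure β) [IsFiniteMeasure ρ]
    [IsFiniteMeasure ν] {a : β → ℝ} (ha : Measurable a) {M : ℝ} (hM : ∀ y, ‖a y‖ ≤ M) :
    ∫ y, a y ∂ρ = ∫ y, a y * (ρ.rnDeriv ν y).toReal ∂ν + ∫ y, a y ∂(ρ.singularPart ν) := by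
  conv_lhs => rw [Measure.haveLebesgueDecomposition_add ρ ν]
  rw [integral_add_measure (integrable_of_norm_le _ ha hM) (integrable_of_norm_le _ ha hM),
    integral_withDensity_eq_integral_toReal_smul (Measure.measurable_rnDeriv _ _)
      (Measure.rnDeriv_lt_top _ _), add_comm]
  simp only [smul_eq_mul, mul_comm]

/-- The dual functionals bound the divergence from below. -/
theorem ofReal_integral_add_integral_le_phiDivergence {φ : ℝ≥0 → ℝ≥0∞} (ρ ν : Measure β)
    [IsFiniteMeasure ρ] [IsFiniteMeasure ν] {ψ : β → ℝ × ℝ} (hψ : Measurable ψ) {M : ℝ}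
    (hM : ∀ y, ‖ψ y‖ ≤ M) (hK : ∀ y, ψ y ∈ affineMinorants φ) :
    ENNReal.ofReal (∫ y, (ψ y).1 ∂ρ + ∫ y, (ψ y).2 ∂ν) ≤ phiDivergence φ ρ ν := by
  have hM1 : ∀ y, ‖(ψ y).1‖ ≤ M := fun y => (norm_fst_le _).trans (hM y)
  have hM2 : ∀ y, ‖(ψ y).2‖ ≤ M := fun y => (norm_snd_le _).trans (hM y)
  have hi1 := integrable_mul_rnDeriv ρ ν hψ.fst hM1
  have hi2 := integrable_of_norm_le ν hψ.snd hM2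
  rw [integral_eq_rnDeriv_add_singularPart ρ ν hψ.fst hM1, add_right_comm,
    ← integral_add hi1 hi2]
  refine ENNReal.ofReal_add_le.trans (add_le_add ?_ ?_)
  · refine (ofReal_integral_le_lintegral ν (hi1.add hi2)).trans (lintegral_mono fun y => ?_)
    exact hK y (ρ.rnDeriv ν y).toNNReal
  · refine (ofReal_integral_le_lintegral _ (integrable_of_norm_le _ hψ.fst hM1)).trans ?_
    rw [← lintegral_const]
    exact lintegral_mono fun y => fst_le_growthRate (hK y)

theorem exists_measurable_index_max {g : ℕ → β → ℝ} (hg : ∀ i, Measurable (g i)) (k : ℕ) :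
    ∃ idx : β → ℕ, Measurable idx ∧ (∀ y, idx y ≤ k) ∧ ∀ y, ∀ i ≤ k, g i y ≤ g (idx y) y := by
  classical
  induction k with
  | zero => exact ⟨fun _ => 0, measurable_const, by simp, by simp⟩
  | succ k ih =>
    obtain ⟨j, hj, hjk, hmax⟩ := ih
    have hgj : Measurable fun y => g (j y) y :=
      (measurable_from_prod_countable_right (f := fun p : ℕ × β => g p.1 p.2) hg).comp
        (hj.prodMk measurable_id)
    refine ⟨fun y => if g (j y) y < g (k + 1) y then k + 1 else j y,
      Measurable.ite (measurableSet_lt hgj (hg _)) measurable_const hj, fun y => ?_,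
      fun y i hi => ?_⟩
    · dsimp only
      have := hjk y
      split_ifs <;> omega
    · dsimp only
      rcases Nat.le_succ_iff.1 hi with h | rfl
      · have := hmax y i h
        split_ifs with hlt
        · exact this.trans hlt.le
        · exact this
      · split_ifs with hlt
        · exact le_rfl
        · exact not_lt.1 hlt

/-- The minorants form a subset of the plane, hence a separable set, and evaluation is continuous in
the coefficients, so a dense sequence suffices. Starting it with `0` keeps the running maxima
nonnegative. -/
theorem IsEntropyFunction.exists_affineMinorant_seq {φ : ℝ≥0 → ℝ≥0∞}
    (hφ : IsEntropyFunction φ) :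
    ∃ v : ℕ → ℝ × ℝ, v 0 = 0 ∧ (∀ i, v i ∈ affineMinorants φ) ∧
      (∀ s : ℝ≥0, φ s = ⨆ i, ENNReal.ofReal ((v i).1 * s + (v i).2)) ∧
      growthRate φ = ⨆ i, ENNReal.ofReal (v i).1 := by
  have : Nonempty (affineMinorants φ) := ⟨⟨0, zero_mem_affineMinorants φ⟩⟩
  set w : ℕ → affineMinorants φ := TopologicalSpace.denseSeq _
  have hw : DenseRange w := TopologicalSpace.denseRange_denseSeq _
  set v : ℕ → ℝ × ℝ := fun i => Nat.casesOn i 0 (fun j => (w j : ℝ × ℝ)) with hv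
  have hvK : ∀ i, v i ∈ affineMinorants φ := by
    rintro (_ | i)
    · exact zero_mem_affineMinorants φ
    · exact (w i).2
  have key : ∀ (l : ℝ × ℝ → ℝ), Continuous l → ∀ c, (∃ u ∈ affineMinorants φ, c < l u) →
      ∃ i, c < l (v i) := by
    rintro l hl c ⟨u, hu, hcu⟩
    obtain ⟨_, hx, ⟨i, rfl⟩⟩ := hw.inter_open_nonempty {u : affineMinorants φ | c < l u}
      (isOpen_lt continuous_const (hl.comp continuous_subtype_val)) ⟨⟨u, hu⟩, hcu⟩
    exact ⟨i + 1, hx⟩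
  refine ⟨v, rfl, hvK, fun s => le_antisymm ?_ (iSup_le fun i => hvK i s),
    le_antisymm ?_ (iSup_le fun i => fst_le_growthRate (hvK i))⟩
  · refine le_of_forall_lt fun c hc => ?_
    obtain ⟨d, hcd, hd⟩ := exists_between hc
    have hdt := hd.ne_top
    rw [← ENNReal.ofReal_toReal hdt] at hd
    obtain ⟨i, hi⟩ := key (fun u => u.1 * s + u.2) (by fun_prop) _
      (hφ.exists_affineMinorant_gt hd)
    refine hcd.trans_le (le_iSup_of_le i ?_)
    rw [← ENNReal.ofReal_toReal hdt]
    exact ENNReal.ofReal_le_ofReal hi.le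
  · refine le_of_forall_lt fun c hc => ?_
    obtain ⟨d, hcd, hd⟩ := exists_between hc
    have hdt := hd.ne_top
    rw [← ENNReal.ofReal_toReal hdt] at hd
    obtain ⟨i, hi⟩ := key (fun u => u.1) (by fun_prop) _
      (hφ.exists_affineMinorant_fst_gt ENNReal.toReal_nonneg hd)
    refine hcd.trans_le (le_iSup_of_le i ?_)
    rw [← ENNReal.ofReal_toReal hdt]
    exact ENNReal.ofReal_le_ofReal hi.le

/-- The divergence is approximated by dual functionals with finitely many values. -/
theorem IsEntropyFunction.exists_index_lt_integral_add_integral {φ : ℝ≥0 → ℝ≥0∞}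
    (hφ : IsEntropyFunction φ) (ρ ν : Measure β) [IsFiniteMeasure ρ] [IsFiniteMeasure ν]
    {c : ℝ} (hc0 : 0 ≤ c) (hc : ENNReal.ofReal c < phiDivergence φ ρ ν) :
    ∃ (v : ℕ → ℝ × ℝ) (k : ℕ) (idx : β → ℕ), (∀ i, v i ∈ affineMinorants φ) ∧
      Measurable idx ∧ (∀ y, idx y ≤ k) ∧
      c < ∫ y, (v (idx y)).1 ∂ρ + ∫ y, (v (idx y)).2 ∂ν := by
  classical
  obtain ⟨v, hv0, hvK, hvφ, hvg⟩ := hφ.exists_affineMinorant_seq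
  set hs := Measure.mutuallySingular_singularPart ρ ν
  set N := hs.nullSet
  have hN : MeasurableSet N := hs.measurableSet_nullSet
  have hsN : ∀ᵐ y ∂(ρ.singularPart ν), y ∉ N := by
    rw [ae_iff]; simp only [not_not]; exact hs.measure_nullSet
  have hνN : ∀ᵐ y ∂ν, y ∈ N := by
    rw [ae_iff]; exact hs.measure_compl_nullSet
  set f : β → ℝ≥0 := fun y => (ρ.rnDeriv ν y).toNNReal with hf_def
  have hf : Measurable f := (Measure.measurable_rnDeriv ρ ν).ennreal_toNNReal
  -- `N` carries `ν` and is null for the singular part, so one function serves both: the minorant at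
  -- the density on `N`, its slope off `N`.
  set g : ℕ → β → ℝ := fun i y => if y ∈ N then (v i).1 * f y + (v i).2 else (v i).1 with hg_def
  have hg : ∀ i, Measurable (g i) := fun i =>
    Measurable.ite hN (by fun_prop) measurable_const
  choose idx hidx hidxk hmax using exists_measurable_index_max hg
  have hg0 : ∀ k y, 0 ≤ g (idx k y) y := fun k y => by
    have := hmax k y 0 (zero_le)
    simpa [hg_def, hv0] using this
  have hgidx : ∀ k, Measurable fun y => g (idx k y) y := fun k =>
    (measurable_from_prod_countable_right (f := fun p : ℕ × β => g p.1 p.2) hg).comp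
      ((hidx k).prodMk measurable_id)
  set H : ℕ → β → ℝ≥0∞ := fun k y => ENNReal.ofReal (g (idx k y) y)
  have hH : ∀ k, Measurable (H k) := fun k => (hgidx k).ennreal_ofReal
  have hHmono : Monotone H := fun k l hkl y =>
    ENNReal.ofReal_le_ofReal (hmax l y _ ((hidxk k y).trans hkl))
  have hHsup : ∀ y, ⨆ k, H k y = ⨆ i, ENNReal.ofReal (g i y) := fun y =>
    le_antisymm (iSup_le fun k => le_iSup (fun i => ENNReal.ofReal (g i y)) (idx k y))
      (iSup_le fun i => le_iSup_of_le i (ENNReal.ofReal_le_ofReal (hmax i y i le_rfl)))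
  -- Against `σ` the divergence is a single integral of an increasing supremum, so monotone
  -- convergence yields a finite stage `k`.
  set σ := ν + ρ.singularPart ν
  have hD : phiDivergence φ ρ ν = ∫⁻ y, ⨆ k, H k y ∂σ := by
    rw [lintegral_add_measure, phiDivergence]
    congr 1
    · refine lintegral_congr_ae ?_
      filter_upwards [hνN] with y hy
      rw [hHsup, hvφ]
      simp [hg_def, hy, f]
    · rw [← lintegral_const]
      refine lintegral_congr_ae ?_
      filter_upwards [hsN] with y hy
      rw [hHsup, hvg]
      simp [hg_def, hy]
  rw [hD, lintegral_iSup hH hHmono, lt_iSup_iff] at hc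
  obtain ⟨k, hk⟩ := hc
  refine ⟨v, k, idx k, hvK, hidx k, hidxk k, ?_⟩
  set ψ : β → ℝ × ℝ := fun y => v (idx k y)
  have hψ : Measurable ψ := (measurable_from_nat (f := v)).comp (hidx k)
  obtain ⟨M, hM⟩ : ∃ M, ∀ y, ‖ψ y‖ ≤ M :=
    ⟨∑ i ∈ Finset.range (k + 1), ‖v i‖, fun y => Finset.single_le_sum
      (f := fun i => ‖v i‖) (fun i _ => norm_nonneg _)
      (Finset.mem_range.2 (Nat.lt_succ_of_le (hidxk k y)))⟩
  have hM1 : ∀ y, ‖(ψ y).1‖ ≤ M := fun y => (norm_fst_le _).trans (hM y)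
  have hM2 : ∀ y, ‖(ψ y).2‖ ≤ M := fun y => (norm_snd_le _).trans (hM y)
  have hi1 := integrable_mul_rnDeriv ρ ν hψ.fst hM1
  have hi2 := integrable_of_norm_le ν hψ.snd hM2
  have hi3 := integrable_of_norm_le (ρ.singularPart ν) hψ.fst hM1
  have e1 : (fun y => (ψ y).1 * (ρ.rnDeriv ν y).toReal + (ψ y).2)
      =ᵐ[ν] fun y => g (idx k y) y := by
    filter_upwards [hνN] with y hy
    simp only [hg_def, hy, if_true, ψ, f]
    rfl
  have e2 : (fun y => (ψ y).1) =ᵐ[ρ.singularPart ν] fun y => g (idx k y) y := by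
    filter_upwards [hsN] with y hy
    simp [hg_def, hy, ψ]
  have hint : Integrable (fun y => g (idx k y) y) σ :=
    ((hi1.add hi2).congr e1).add_measure (hi3.congr e2)
  have heq : ∫ y, (ψ y).1 ∂ρ + ∫ y, (ψ y).2 ∂ν = ∫ y, g (idx k y) y ∂σ := by
    rw [integral_eq_rnDeriv_add_singularPart ρ ν hψ.fst hM1, add_right_comm,
      ← integral_add hi1 hi2, integral_congr_ae e1, integral_congr_ae e2,
      integral_add_measure ((hi1.add hi2).congr e1) (hi3.congr e2)]
  have hk' : ENNReal.ofReal c < ∫⁻ y, ENNReal.ofReal (g (idx k y) y) ∂σ := hk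
  rw [← ofReal_integral_eq_lintegral_ofReal hint (ae_of_all _ (hg0 k)),
    ENNReal.ofReal_lt_ofReal_iff_of_nonneg hc0] at hk'
  exact hk'.trans_eq heq.symm

end Duality

/-! ### Convexity of the divergence -/

section Convexity

variable {β : Type*} [MeasurableSpace β]

theorem exists_norm_bound_comp (v : ℕ → ℝ × ℝ) {k : ℕ} :
    ∃ M, 0 ≤ M ∧ ∀ i ≤ k, ‖v i‖ ≤ M :=
  ⟨∑ i ∈ Finset.range (k + 1), ‖v i‖, by positivity, fun _ hi => Finset.single_le_sum
      (f := fun i => ‖v i‖) (fun i _ => norm_nonneg _) (Finset.mem_range.2 (Nat.lt_succ_of_le hi))⟩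

/-- The divergence is convex in its first argument. -/
theorem IsEntropyFunction.phiDivergence_combo_le {φ : ℝ≥0 → ℝ≥0∞} (hφ : IsEntropyFunction φ)
    (ρ₁ ρ₂ ν : Measure β) [IsFiniteMeasure ρ₁] [IsFiniteMeasure ρ₂] [IsFiniteMeasure ν]
    {a b : ℝ≥0} (hab : a + b = 1) (h₁ : phiDivergence φ ρ₁ ν ≠ ∞)
    (h₂ : phiDivergence φ ρ₂ ν ≠ ∞) :
    phiDivergence φ (a • ρ₁ + b • ρ₂) ν ≤ ENNReal.ofReal
      (a * (phiDivergence φ ρ₁ ν).toReal + b * (phiDivergence φ ρ₂ ν).toReal) := by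
  -- A dual functional is affine in the first measure, so if it exceeds the combined bound at the
  -- mixture it violates the bound at an endpoint.
  by_contra! hlt
  obtain ⟨v, k, idx, hvK, hidx, hidxk, hc⟩ :=
    hφ.exists_index_lt_integral_add_integral _ ν (by positivity) hlt
  obtain ⟨M, -, hM⟩ := exists_norm_bound_comp v (k := k)
  have hψ : Measurable fun y => v (idx y) := (measurable_from_nat (f := v)).comp hidx
  have hM' : ∀ y, ‖v (idx y)‖ ≤ M := fun y => hM _ (hidxk y)
  have hM1 : ∀ y, ‖(v (idx y)).1‖ ≤ M := fun y => (norm_fst_le _).trans (hM' y)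
  have b1 := (ENNReal.ofReal_le_iff_le_toReal h₁).1
    (ofReal_integral_add_integral_le_phiDivergence ρ₁ ν hψ hM' fun y => hvK _)
  have b2 := (ENNReal.ofReal_le_iff_le_toReal h₂).1
    (ofReal_integral_add_integral_le_phiDivergence ρ₂ ν hψ hM' fun y => hvK _)
  rw [integral_add_measure (integrable_of_norm_le _ hψ.fst hM1)
    (integrable_of_norm_le _ hψ.fst hM1), integral_smul_nnreal_measure,
    integral_smul_nnreal_measure] at hc
  simp only [NNReal.smul_def, smul_eq_mul] at hc
  have hab' : (a : ℝ) + b = 1 := by exact_mod_cast hab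
  have e : ∫ y, (v (idx y)).2 ∂ν = a * ∫ y, (v (idx y)).2 ∂ν + b * ∫ y, (v (idx y)).2 ∂ν := by
    rw [← add_mul, hab', one_mul]
  rw [e] at hc
  have := mul_le_mul_of_nonneg_left b1 a.2
  have := mul_le_mul_of_nonneg_left b2 b.2
  simp only [NNReal.val_eq_coe] at *
  linarith

theorem phiDivergence_self (φ : ℝ≥0 → ℝ≥0∞) (ν : Measure β) [IsProbabilityMeasure ν] :
    phiDivergence φ ν ν = φ 1 := by
  rw [phiDivergence, Measure.singularPart_self]
  simp only [Measure.coe_zero, Pi.zero_apply, mul_zero, add_zero]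
  rw [lintegral_congr_ae (g := fun _ => φ 1)]
  · simp
  · filter_upwards [Measure.rnDeriv_self ν] with y hy
    simp [hy]

theorem norm_integral_sub_le_of_eqOn_compl (μ : Measure β) [IsFiniteMeasure μ] {f g : β → ℝ}
    (hf : Measurable f) (hg : Measurable g) {M : ℝ} (hfM : ∀ y, ‖f y‖ ≤ M) (hgM : ∀ y, ‖g y‖ ≤ M)
    {s : Set β} (h : ∀ y ∉ s, f y = g y) :
    ‖∫ y, f y ∂μ - ∫ y, g y ∂μ‖ ≤ 2 * M * μ.real s := by
  rw [← integral_sub (integrable_of_norm_le μ hf hfM) (integrable_of_norm_le μ hg hgM),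
    ← setIntegral_eq_integral_of_forall_compl_eq_zero (s := s) fun y hy => by simp [h y hy]]
  refine norm_setIntegral_le_of_norm_le_const (measure_lt_top _ _) fun y _ => ?_
  exact (norm_sub_le _ _).trans (by linarith [hfM y, hgM y])

end Convexity

/-! ### Weak lower semicontinuity of the divergence -/

section Semicontinuity

variable {β : Type*} [PseudoMetricSpace β] [MeasurableSpace β] [BorelSpace β]

/-- A Lusin-type statement: inner regularity shrinks each of the finitely many level sets to a
closed set, and near a point of one piece the union of the others is avoided. -/
theorem exists_isClosed_locally_constant (σ : Measure β) [IsFiniteMeasure σ] {idx : β → ℕ} {k : ℕ}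
    (hidx : Measurable idx) (hk : ∀ y, idx y ≤ k) {ε : ℝ≥0∞} (hε : ε ≠ 0) :
    ∃ F : Set β, IsClosed F ∧ σ Fᶜ ≤ ε ∧
      ∀ y ∈ F, ∀ᶠ z in 𝓝 y, z ∈ F → idx z = idx y := by
  have hδ : ε / (k + 1 : ℕ) ≠ 0 := by
    simp [ENNReal.div_eq_zero_iff, hε]
  choose F hFsub hF hFσ using fun i : ℕ =>
    (hidx (measurableSet_singleton i)).exists_isClosed_sdiff_lt (μ := σ) (measure_ne_top _ _) hδ
  refine ⟨⋃ i ∈ Finset.range (k + 1), F i, isClosed_biUnion_finset fun i _ => hF i, ?_, ?_⟩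
  · have hsub : (⋃ i ∈ Finset.range (k + 1), F i)ᶜ
        ⊆ ⋃ i ∈ Finset.range (k + 1), (idx ⁻¹' {i} \ F i) := by
      intro y hy
      have hmem := Finset.mem_range.2 (Nat.lt_succ_of_le (hk y))
      refine mem_biUnion (Finset.mem_coe.2 hmem) ⟨rfl, fun h => hy ?_⟩
      exact mem_biUnion (Finset.mem_coe.2 hmem) h
    calc σ _ ≤ ∑ i ∈ Finset.range (k + 1), σ (idx ⁻¹' {i} \ F i) :=
          (measure_mono hsub).trans (measure_biUnion_finset_le _ _)
      _ ≤ ∑ i ∈ Finset.range (k + 1), ε / (k + 1 : ℕ) :=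
          Finset.sum_le_sum fun i _ => (hFσ i).le
      _ = ε := by
          rw [Finset.sum_const, Finset.card_range, nsmul_eq_mul]
          exact ENNReal.mul_div_cancel (by simp) (by simp)
  · intro y hy
    have hopen : IsOpen (⋃ i ∈ (Finset.range (k + 1)).erase (idx y), F i)ᶜ :=
      (isClosed_biUnion_finset fun i _ => hF i).isOpen_compl
    filter_upwards [hopen.mem_nhds (by
      simp only [mem_compl_iff, mem_iUnion, not_exists]
      intro i hi hyi
      exact (Finset.mem_erase.1 hi).1 (hFsub i hyi).symm)] with z hz hzF
    simp only [mem_iUnion] at hzF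
    obtain ⟨i, hi, hzi⟩ := hzF
    have hzi' : idx z = i := hFsub i hzi
    by_contra hne
    exact hz (mem_biUnion (Finset.mem_coe.2
      (Finset.mem_erase.2 ⟨fun h => hne (hzi'.trans h), hi⟩)) hzi)

/-- The divergence is approximated by bounded continuous dual functionals. -/
theorem IsEntropyFunction.exists_continuous_lt_integral_add_integral {φ : ℝ≥0 → ℝ≥0∞}
    (hφ : IsEntropyFunction φ) (ρ ν : Measure β) [IsFiniteMeasure ρ] [IsFiniteMeasure ν]
    {c : ℝ} (hc0 : 0 ≤ c) (hc : ENNReal.ofReal c < phiDivergence φ ρ ν) :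
    ∃ (g : C(β, ℝ × ℝ)) (M : ℝ), (∀ y, ‖g y‖ ≤ M) ∧ (∀ y, g y ∈ affineMinorants φ) ∧
      c < ∫ y, (g y).1 ∂ρ + ∫ y, (g y).2 ∂ν := by
  classical
  obtain ⟨v, k, idx, hvK, hidx, hidxk, hlt⟩ :=
    hφ.exists_index_lt_integral_add_integral ρ ν hc0 hc
  obtain ⟨M, hM0, hM⟩ := exists_norm_bound_comp v (k := k)
  set ε := ∫ y, (v (idx y)).1 ∂ρ + ∫ y, (v (idx y)).2 ∂ν - c with hε
  have hε0 : 0 < ε := sub_pos.2 hlt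
  -- Changing the functions off `F` costs at most `2 * M` times the mass there; the `+ 1` covers `M
  -- = 0`.
  obtain ⟨F, hF, hFσ, hloc⟩ := exists_isClosed_locally_constant (ρ + ν) hidx hidxk
    (ε := ENNReal.ofReal (ε / (2 * M + 1))) (by
      rw [Ne, ENNReal.ofReal_eq_zero, not_le]; positivity)
  set C := convexHull ℝ (v '' Iic k)
  have hvC : ∀ y, v (idx y) ∈ C := fun y => subset_convexHull ℝ _ ⟨_, hidxk y, rfl⟩
  have hCK : C ⊆ affineMinorants φ :=
    convexHull_min (by rintro _ ⟨i, -, rfl⟩; exact hvK i) (convex_affineMinorants φ)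
  have hCM : C ⊆ Metric.closedBall 0 M :=
    convexHull_min (by rintro _ ⟨i, hi, rfl⟩; simpa using hM i hi) (convex_closedBall _ _)
  -- The value is prescribed on `F` and free in the convex hull off `F`. Constants are local
  -- selections, so a continuous one exists; it stays among the minorants because these form a
  -- convex set.
  set t : β → Set (ℝ × ℝ) := fun y => if y ∈ F then {v (idx y)} else C with ht
  obtain ⟨g, hg⟩ := exists_continuous_forall_mem_convex_of_local_const (t := t)
    (fun y => by
      dsimp only [t]
      split_ifs
      exacts [convex_singleton _, convex_convexHull ℝ _])
    (fun y => by
      refine ⟨v (idx y), ?_⟩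
      by_cases hy : y ∈ F
      · filter_upwards [hloc y hy] with z hz
        by_cases hzF : z ∈ F
        · simp [ht, hzF, hz hzF]
        · simpa [ht, hzF] using hvC y
      · filter_upwards [hF.isOpen_compl.mem_nhds hy] with z hz
        have hzF : z ∉ F := hz
        simpa [ht, hzF] using hvC y)
  have hgC : ∀ y, g y ∈ C := fun y => by
    have := hg y
    dsimp only [t] at this
    split_ifs at this
    · rw [this]; exact hvC y
    · exact this
  have hgF : ∀ y ∈ F, g y = v (idx y) := fun y hy => by
    have := hg y
    simpa [ht, hy] using this
  have hgM : ∀ y, ‖g y‖ ≤ M := fun y => by simpa using hCM (hgC y)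
  have hvM : ∀ y, ‖v (idx y)‖ ≤ M := fun y => hM _ (hidxk y)
  have hψ : Measurable fun y => v (idx y) := (measurable_from_nat (f := v)).comp hidx
  have hgm : Measurable g := g.continuous.measurable
  refine ⟨g, M, hgM, fun y => hCK (hgC y), ?_⟩
  have d1 := norm_integral_sub_le_of_eqOn_compl ρ hgm.fst hψ.fst
    (fun y => (norm_fst_le _).trans (hgM y)) (fun y => (norm_fst_le _).trans (hvM y)) (s := Fᶜ)
    (fun y hy => by rw [hgF y (by simpa using hy)])
  have d2 := norm_integral_sub_le_of_eqOn_compl ν hgm.snd hψ.snd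
    (fun y => (norm_snd_le _).trans (hgM y)) (fun y => (norm_snd_le _).trans (hvM y)) (s := Fᶜ)
    (fun y hy => by rw [hgF y (by simpa using hy)])
  have hsum : ρ.real Fᶜ + ν.real Fᶜ ≤ ε / (2 * M + 1) := by
    rw [← measureReal_add_apply]
    exact ENNReal.toReal_le_of_le_ofReal (by positivity) hFσ
  have hlt' : 2 * M * (ρ.real Fᶜ + ν.real Fᶜ) < ε := by
    refine (mul_le_mul_of_nonneg_left hsum (by positivity)).trans_lt ?_
    rw [mul_div_assoc', div_lt_iff₀ (by positivity)]
    nlinarith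
  have d1' := (abs_le.1 d1).1
  have d2' := (abs_le.1 d2).1
  linarith

/-- Sublevel sets of the divergence are closed under weak limits. -/
theorem IsEntropyFunction.phiDivergence_le_of_tendsto {φ : ℝ≥0 → ℝ≥0∞} (hφ : IsEntropyFunction φ)
    {ι : Type*} {l : Filter ι} [l.NeBot] {ρ : ι → ProbabilityMeasure β} {ρ' : ProbabilityMeasure β}
    (ν : Measure β) [IsFiniteMeasure ν] (hρ : Tendsto ρ l (𝓝 ρ')) {r : ι → ℝ} {r' : ℝ}
    (hr : Tendsto r l (𝓝 r')) (hr0 : ∀ i, 0 ≤ r i)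
    (hle : ∀ i, phiDivergence φ (ρ i) ν ≤ ENNReal.ofReal (r i)) :
    phiDivergence φ ρ' ν ≤ ENNReal.ofReal r' := by
  have hr0' : 0 ≤ r' := ge_of_tendsto' hr hr0
  by_contra! hlt
  obtain ⟨g, M, hgM, hgK, hg⟩ := hφ.exists_continuous_lt_integral_add_integral _ ν hr0' hlt
  have hle' : ∀ i, ∫ y, (g y).1 ∂(ρ i : Measure β) + ∫ y, (g y).2 ∂ν ≤ r i := fun i =>
    (ENNReal.ofReal_le_ofReal_iff (hr0 i)).1
      ((ofReal_integral_add_integral_le_phiDivergence _ ν g.continuous.measurable hgM hgK).trans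
        (hle i))
  set g₁ : BoundedContinuousFunction β ℝ := BoundedContinuousFunction.ofNormedAddCommGroup
    (fun y => (g y).1) (by fun_prop) M (fun y => (norm_fst_le _).trans (hgM y))
  have hlim : Tendsto (fun i => ∫ y, (g y).1 ∂(ρ i : Measure β)) l
      (𝓝 (∫ y, (g y).1 ∂(ρ' : Measure β))) :=
    ProbabilityMeasure.tendsto_iff_forall_integral_tendsto.1 hρ g₁
  have := le_of_tendsto_of_tendsto' (hlim.add_const _) hr hle'
  linarith

end Semicontinuity

/-! ### Tightness of divergence sublevel sets -/

section Tightness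

variable {β : Type*} [TopologicalSpace β] [MeasurableSpace β] [BorelSpace β]

/-- With superlinear growth, sublevel sets of the divergence are uniformly tight. -/
theorem IsEntropyFunction.exists_isCompact_measure_compl_le [T2Space β] {φ : ℝ≥0 → ℝ≥0∞}
    (hφ : IsEntropyFunction φ) (hgrowth : growthRate φ = ∞) (ν : Measure β) [IsFiniteMeasure ν]
    (hν : IsTightMeasureSet {ν}) (e : ℝ) {ε : ℝ≥0∞} (hε : 0 < ε) :
    ∃ K : Set β, IsCompact K ∧ ∀ ρ : Measure β, IsFiniteMeasure ρ →
      phiDivergence φ ρ ν ≤ ENNReal.ofReal e → ρ Kᶜ ≤ ε := by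
  wlog hεtop : ε ≠ ∞ generalizing ε
  · obtain ⟨K, hK, h⟩ := this zero_lt_one ENNReal.one_ne_top
    refine ⟨K, hK, fun ρ hρ h' => ?_⟩
    simp only [ne_eq, not_not] at hεtop
    simp [hεtop]
  classical
  set δ := ε.toReal
  have hδ : 0 < δ := ENNReal.toReal_pos hε.ne' hεtop
  -- Testing with `v` on `Kᶜ` and `0` on `K` will give `ρ Kᶜ * v.1 ≤ max e 0 + 1`, once `K` makes
  -- the `ν` term at most `1`; this slope turns that into `ρ Kᶜ ≤ δ`.
  obtain ⟨v, hv, hva⟩ := hφ.exists_affineMinorant_fst_gt (c := (max e 0 + 1) / δ) (by positivity)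
    (by rw [hgrowth]; exact ENNReal.ofReal_lt_top)
  obtain ⟨K, hK, hKν⟩ := isTightMeasureSet_iff_exists_isCompact_measure_compl_le.1 hν
    (ENNReal.ofReal (1 / (|v.2| + 1))) (by rw [ENNReal.ofReal_pos]; positivity)
  have hKν' : ν.real Kᶜ ≤ 1 / (|v.2| + 1) :=
    ENNReal.toReal_le_of_le_ofReal (by positivity) (hKν ν rfl)
  have hKm : MeasurableSet Kᶜ := hK.measurableSet.compl
  refine ⟨K, hK, fun ρ _ hρ => ?_⟩
  set ψ : β → ℝ × ℝ := Kᶜ.indicator fun _ => v with hψ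
  have hψm : Measurable ψ := measurable_const.indicator hKm
  have key := (ofReal_integral_add_integral_le_phiDivergence ρ ν hψm (M := ‖v‖)
    (fun y => norm_indicator_le_norm_self (fun _ => v) y)
    (fun y => by
      by_cases hy : y ∈ Kᶜ
      · simpa only [hψ, indicator_of_mem hy] using hv
      · simpa only [hψ, indicator_of_notMem hy] using zero_mem_affineMinorants φ)).trans
    (hρ.trans (ENNReal.ofReal_le_ofReal (le_max_left e 0)))
  rw [ENNReal.ofReal_le_ofReal_iff (le_max_right _ _)] at key
  have e1 : ∫ y, (ψ y).1 ∂ρ = ρ.real Kᶜ * v.1 := by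
    have : (fun y => (ψ y).1) = Kᶜ.indicator fun _ => v.1 := by
      ext y; by_cases hy : y ∈ Kᶜ <;> simp [hψ, hy]
    rw [this, integral_indicator_const _ hKm, smul_eq_mul]
  have e2 : ∫ y, (ψ y).2 ∂ν = ν.real Kᶜ * v.2 := by
    have : (fun y => (ψ y).2) = Kᶜ.indicator fun _ => v.2 := by
      ext y; by_cases hy : y ∈ Kᶜ <;> simp [hψ, hy]
    rw [this, integral_indicator_const _ hKm, smul_eq_mul]
  rw [e1, e2] at key
  have h1 : ν.real Kᶜ * |v.2| ≤ 1 := by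
    have hb := abs_nonneg v.2
    rw [le_div_iff₀ (by positivity)] at hKν'
    nlinarith [measureReal_nonneg (μ := ν) (s := Kᶜ)]
  have h2 : ρ.real Kᶜ * v.1 ≤ max e 0 + 1 := by
    have := mul_le_mul_of_nonneg_left (neg_abs_le v.2) (measureReal_nonneg (μ := ν) (s := Kᶜ))
    linarith
  have h3 : ρ.real Kᶜ ≤ δ := by
    rw [div_lt_iff₀ hδ] at hva
    have hv1 : 0 < v.1 := by
      by_contra! hneg
      have := le_max_right e 0
      nlinarith
    refine le_of_mul_le_mul_right (h2.trans ?_) hv1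
    linarith
  exact (ENNReal.le_ofReal_iff_toReal_le (measure_ne_top _ _) hδ.le).2 h3 |>.trans
    ENNReal.ofReal_toReal_le

end Tightness

/-! ### Separation in the plane -/

section Planar

variable {W : Set (ℝ × ℝ)}

/-- Lagrange multipliers for a planar convex program under Slater's condition. -/
theorem exists_multiplier_of_slater (hW : Convex ℝ W) {v η : ℝ} (hslater : ∃ z ∈ W, z.2 < η)
    (hv : ∀ z ∈ W, z.2 ≤ η → v ≤ z.1) :
    ∃ θ : ℝ, 0 ≤ θ ∧ ∀ z ∈ W, v + θ * η ≤ z.1 + θ * z.2 := by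
  -- `θ` lies between the slopes from points above height `η` and those from points below. They are
  -- ordered because the joining segment crosses height `η` at cost at least `v`; the inserted `0`
  -- makes `θ` nonnegative.
  obtain ⟨θ, hlow, hupp⟩ := exists_between_of_forall_le
    (s := insert 0 ((fun z : ℝ × ℝ => (v - z.1) / (z.2 - η)) '' {z ∈ W | η < z.2}))
    (t := (fun z : ℝ × ℝ => (z.1 - v) / (η - z.2)) '' {z ∈ W | z.2 < η})
    (insert_nonempty _ _) (Nonempty.image _ hslater) (by
      rintro _ (rfl | ⟨z, ⟨hz, hzη⟩, rfl⟩) _ ⟨w, ⟨hw, hwη⟩, rfl⟩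
      · exact div_nonneg (sub_nonneg.2 (hv w hw hwη.le)) (sub_nonneg.2 hwη.le)
      · dsimp only
        rw [div_le_div_iff₀ (by linarith) (by linarith)]
        have hd : 0 < z.2 - w.2 := by linarith
        have hmem := hW hz hw (a := (η - w.2) / (z.2 - w.2)) (b := (z.2 - η) / (z.2 - w.2))
          (div_nonneg (by linarith) hd.le) (div_nonneg (by linarith) hd.le)
          (by rw [← add_div, div_eq_one_iff_eq hd.ne']; ring)
        have h2 := hv _ hmem (le_of_eq (by
          simp only [Prod.snd_add, Prod.smul_snd, smul_eq_mul]
          field_simp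
          ring))
        simp only [Prod.fst_add, Prod.smul_fst, smul_eq_mul] at h2
        rw [div_mul_eq_mul_div, div_mul_eq_mul_div, ← add_div, le_div_iff₀ hd] at h2
        linarith)
  refine ⟨θ, hlow (mem_insert _ _), fun z hz => ?_⟩
  rcases lt_trichotomy z.2 η with h | h | h
  · have := hupp (mem_image_of_mem _ ⟨hz, h⟩)
    rw [le_div_iff₀ (by linarith)] at this
    linarith
  · rw [h]
    linarith [hv z hz h.le]
  · have := hlow (mem_insert_of_mem _ (mem_image_of_mem _ ⟨hz, h⟩))
    rw [div_le_iff₀ (by linarith)] at this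
    linarith

/-- A point outside a closed convex planar set of attainable costs is excluded by a
nonnegative multiplier. -/
theorem exists_multiplier_of_notMem (hW : Convex ℝ W) (hclosed : IsClosed W)
    (hup : ∀ z ∈ W, ∀ z' : ℝ × ℝ, z.1 ≤ z'.1 → z.2 ≤ z'.2 → z' ∈ W) {m : ℝ}
    (hm : ∀ z ∈ W, m ≤ z.1) {B η : ℝ} (hB : (B, η) ∉ W) :
    ∃ t : ℝ, 0 ≤ t ∧ ∃ B' : ℝ, B < B' ∧ ∀ z ∈ W, B' + t * η ≤ z.1 + t * z.2 := by
  rcases W.eq_empty_or_nonempty with rfl | ⟨z₀, hz₀⟩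
  · exact ⟨0, le_rfl, B + 1, by linarith, by simp⟩
  obtain ⟨f, u, hfB, hf⟩ := geometric_hahn_banach_point_closed hW hclosed hB
  set α := f (1, 0)
  set β := f (0, 1)
  have hfB' : α * B + β * η < u := by rwa [clm_prod_apply f] at hfB
  have hf' : ∀ z ∈ W, u < α * z.1 + β * z.2 := fun z hz => by
    have := hf z hz
    rwa [clm_prod_apply f] at this
  have hα : 0 ≤ α := by
    by_contra! hneg
    obtain ⟨n, hn⟩ := exists_nat_gt ((α * z₀.1 + β * z₀.2 - u) / (-α))
    have h1 := hf' _ (hup z₀ hz₀ (z₀.1 + n, z₀.2) (by simp) le_rfl)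
    rw [div_lt_iff₀ (by linarith)] at hn
    dsimp only at h1
    linarith
  have hβ : 0 ≤ β := by
    by_contra! hneg
    obtain ⟨n, hn⟩ := exists_nat_gt ((α * z₀.1 + β * z₀.2 - u) / (-β))
    have h1 := hf' _ (hup z₀ hz₀ (z₀.1, z₀.2 + n) le_rfl (by simp))
    rw [div_lt_iff₀ (by linarith)] at hn
    dsimp only at h1
    linarith
  rcases hα.eq_or_lt with hα0 | hα0
  -- The separating line sees only the second coordinate, so `W` lies at height at least `η + d`. A
  -- multiplier with `t * d ≥ B + 1 - m` outweighs the lower bound `m` on the cost.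
  · rw [← hα0] at hfB' hf'
    have hβ0 : 0 < β := by
      refine hβ.lt_of_ne' fun h => ?_
      rw [h] at hfB' hf'
      have := hf' z₀ hz₀
      linarith
    set d := u / β - η with hd
    have hd0 : 0 < d := by
      rw [hd, sub_pos, lt_div_iff₀ hβ0]
      linarith
    have hz : ∀ z ∈ W, η + d ≤ z.2 := fun z hz => by
      have := hf' z hz
      rw [hd, add_sub_cancel, div_le_iff₀ hβ0]
      linarith
    refine ⟨max ((B + 1 - m) / d) 0, le_max_right _ _, B + 1, by linarith, fun z hzW => ?_⟩
    set t := max ((B + 1 - m) / d) 0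
    have ht : B + 1 - m ≤ t * d := (div_le_iff₀ hd0).1 (le_max_left _ _)
    have := mul_le_mul_of_nonneg_left (hz z hzW) (le_max_right ((B + 1 - m) / d) 0)
    have := hm z hzW
    linarith
  · refine ⟨β / α, by positivity, (u - β * η) / α, ?_, fun z hz => ?_⟩
    · rw [lt_div_iff₀ hα0]
      linarith
    · have h1 : (u - β * η) / α + β / α * η = u / α := by ring
      have h2 : z.1 + β / α * z.2 = (α * z.1 + β * z.2) / α := by field_simp
      rw [h1, h2]
      gcongr
      exact (hf' z hz).le

end Planar

/-! ### The set of attainable bounds and its convexity -/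

section ValueSet

variable {α β : Type*} [MeasurableSpace α] [MeasurableSpace β]

/-- The pairs of upper bounds for the expected utility and the divergence that are attained by
some joint law with first marginal `μ`. -/
def attainableBounds (U : α × β → ℝ) (φ : ℝ≥0 → ℝ≥0∞) (ν₀ : ProbabilityMeasure β)
    (μ : ProbabilityMeasure α) : Set (ℝ × ℝ) :=
  {z | 0 ≤ z.2 ∧ ∃ γ ∈ couplings β μ, ∫ p, U p ∂(γ : Measure (α × β)) ≤ z.1 ∧
    marginalDivergence φ ν₀ γ ≤ ENNReal.ofReal z.2}

variable {U : α × β → ℝ} {φ : ℝ≥0 → ℝ≥0∞} {ν₀ : ProbabilityMeasure β}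

theorem attainableBounds_upward {μ : ProbabilityMeasure α} (z : ℝ × ℝ)
    (hz : z ∈ attainableBounds U φ ν₀ μ) (z' : ℝ × ℝ) (h1 : z.1 ≤ z'.1) (h2 : z.2 ≤ z'.2) :
    z' ∈ attainableBounds U φ ν₀ μ := by
  obtain ⟨h0, γ, hγ, hU, hR⟩ := hz
  exact ⟨h0.trans h2, γ, hγ, hU.trans h1, hR.trans (ENNReal.ofReal_le_ofReal h2)⟩

theorem neg_le_integral {M : ℝ} (hM : ∀ p, |U p| ≤ M) (γ : ProbabilityMeasure (α × β)) :
    -M ≤ ∫ p, U p ∂(γ : Measure (α × β)) := by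
  have := norm_integral_le_of_norm_le_const (μ := (γ : Measure (α × β))) (f := U)
    (ae_of_all _ hM)
  rw [probReal_univ, mul_one] at this
  exact (abs_le.1 this).1

theorem convex_attainableBounds (hφ : IsEntropyFunction φ) (hU : Measurable U) {M : ℝ}
    (hM : ∀ p, |U p| ≤ M) (μ : ProbabilityMeasure α) :
    Convex ℝ (attainableBounds U φ ν₀ μ) := by
  rintro z ⟨hz0, γ, hγ, hγU, hγR⟩ w ⟨hw0, γ', hγ', hγU', hγR'⟩ a b ha hb hab
  lift a to ℝ≥0 using ha
  lift b to ℝ≥0 using hb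
  have hab' : a + b = 1 := by exact_mod_cast hab
  have hab'' : (a : ℝ≥0∞) + b = 1 := by exact_mod_cast hab'
  refine ⟨by simp; positivity, ⟨a • (γ : Measure (α × β)) + b • (γ' : Measure (α × β)),
    ⟨by
      rw [Measure.add_apply, Measure.smul_apply, Measure.smul_apply, measure_univ, measure_univ,
        ENNReal.smul_def, ENNReal.smul_def, smul_eq_mul, smul_eq_mul, mul_one, mul_one, hab'']⟩⟩,
    ?_, ?_, ?_⟩
  · change Measure.map Prod.fst _ = _
    rw [ProbabilityMeasure.coe_mk, Measure.map_add _ _ measurable_fst, Measure.map_smul,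
      Measure.map_smul]
    change a • (γ : Measure (α × β)).fst + b • (γ' : Measure (α × β)).fst = _
    rw [show (γ : Measure (α × β)).fst = μ from hγ, show (γ' : Measure (α × β)).fst = μ from hγ',
      ← add_smul, hab', one_smul]
  · rw [ProbabilityMeasure.coe_mk, integral_add_measure (integrable_of_norm_le _ hU hM)
      (integrable_of_norm_le _ hU hM), integral_smul_nnreal_measure, integral_smul_nnreal_measure]
    simp only [NNReal.smul_def, smul_eq_mul, Prod.fst_add, Prod.smul_fst]
    gcongr
  · have hsnd : (a • (γ : Measure (α × β)) + b • (γ' : Measure (α × β))).snd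
        = a • (γ : Measure (α × β)).snd + b • (γ' : Measure (α × β)).snd := by
      simp only [Measure.snd]
      rw [Measure.map_add _ _ measurable_snd, Measure.map_smul, Measure.map_smul]
    change phiDivergence φ (Measure.snd _) _ ≤ _
    rw [ProbabilityMeasure.coe_mk, hsnd]
    refine (hφ.phiDivergence_combo_le _ _ _ hab' (ne_top_of_le_ne_top ENNReal.ofReal_ne_top hγR)
      (ne_top_of_le_ne_top ENNReal.ofReal_ne_top hγR')).trans (ENNReal.ofReal_le_ofReal ?_)
    have h1 := ENNReal.toReal_le_of_le_ofReal hz0 hγR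
    have h2 := ENNReal.toReal_le_of_le_ofReal hw0 hγR'
    simp only [Prod.snd_add, Prod.smul_snd, smul_eq_mul, marginalDivergence] at *
    gcongr

end ValueSet

/-! ### Closedness of the attainable bounds -/

section Compactness

variable {α β : Type*} [MetricSpace α] [CompleteSpace α] [SecondCountableTopology α]
  [MeasurableSpace α] [BorelSpace α] [MetricSpace β] [CompleteSpace β]
  [SecondCountableTopology β] [MeasurableSpace β] [BorelSpace β]
  {U : α × β → ℝ} {φ : ℝ≥0 → ℝ≥0∞} {ν₀ : ProbabilityMeasure β}

/-- Couplings are tight when both families of marginals are: the first marginal is fixed, and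
superlinear growth controls the second. -/
theorem isTightMeasureSet_constrainedCouplings (hφ : IsEntropyFunction φ)
    (h : growthRate φ = ∞ ∨ CompactSpace (α × β)) (μ : ProbabilityMeasure α) (e : ℝ) :
    IsTightMeasureSet {x | ∃ γ ∈ constrainedCouplings φ ν₀ μ e, (γ : Measure (α × β)) = x} := by
  rcases h with h | h
  swap
  · exact IsTightMeasureSet.of_compactSpace
  rw [isTightMeasureSet_iff_exists_isCompact_measure_compl_le]
  intro ε hε
  have hε2 : 0 < ε / 2 := ENNReal.half_pos hε.ne'
  obtain ⟨K₁, hK₁, hμ⟩ := isTightMeasureSet_iff_exists_isCompact_measure_compl_le.1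
    (isTightMeasureSet_singleton (μ := (μ : Measure α))) _ hε2
  obtain ⟨K₂, hK₂, hν⟩ := hφ.exists_isCompact_measure_compl_le h (ν₀ : Measure β)
    isTightMeasureSet_singleton e hε2
  refine ⟨K₁ ×ˢ K₂, hK₁.prod hK₂, ?_⟩
  rintro _ ⟨γ, ⟨hγ, hγe⟩, rfl⟩
  have hsub : (K₁ ×ˢ K₂)ᶜ ⊆ Prod.fst ⁻¹' K₁ᶜ ∪ Prod.snd ⁻¹' K₂ᶜ := by
    rintro ⟨x, y⟩ hxy
    by_cases hx : x ∈ K₁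
    · exact Or.inr fun hy => hxy ⟨hx, hy⟩
    · exact Or.inl hx
  have h1 : (γ : Measure (α × β)) (Prod.fst ⁻¹' K₁ᶜ) ≤ ε / 2 := by
    rw [← Measure.fst_apply hK₁.measurableSet.compl, show (γ : Measure (α × β)).fst = μ from hγ]
    exact hμ _ rfl
  have h2 : (γ : Measure (α × β)) (Prod.snd ⁻¹' K₂ᶜ) ≤ ε / 2 := by
    rw [← Measure.snd_apply hK₂.measurableSet.compl]
    exact hν _ inferInstance hγe
  calc _ ≤ _ := (measure_mono hsub).trans (measure_union_le _ _)
    _ ≤ ε / 2 + ε / 2 := add_le_add h1 h2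
    _ = ε := ENNReal.add_halves ε

/-- Prokhorov's theorem gives a limit coupling; the first marginal and the integral of `U` pass to
the limit, and the divergence bound survives by lower semicontinuity. -/
theorem isClosed_attainableBounds (hφ : IsEntropyFunction φ)
    (h : growthRate φ = ∞ ∨ CompactSpace (α × β)) (hU : Continuous U) {M : ℝ}
    (hM : ∀ p, |U p| ≤ M) (μ : ProbabilityMeasure α) :
    IsClosed (attainableBounds U φ ν₀ μ) := by
  refine isClosed_of_closure_subset fun z hz => ?_
  obtain ⟨w, hw, hwz⟩ := mem_closure_iff_seq_limit.1 hz
  have hw1 := (continuous_fst.tendsto z).comp hwz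
  have hw2 := (continuous_snd.tendsto z).comp hwz
  choose hw0 γ hγ hγU hγR using hw
  -- Convergent heights are bounded, so all the couplings lie in one tight sublevel set.
  obtain ⟨e, he⟩ := hw2.bddAbove_range
  have hcomp := isCompact_closure_of_isTightMeasureSet
    (isTightMeasureSet_constrainedCouplings (ν₀ := ν₀) hφ h μ e)
  set G : Ultrafilter ℕ := Ultrafilter.of atTop
  have hG : (G : Filter ℕ) ≤ atTop := Ultrafilter.of_le _
  obtain ⟨γ', -, hγ'⟩ := hcomp.ultrafilter_le_nhds (G.map γ) (by
    rw [Ultrafilter.coe_map, le_principal_iff, mem_map]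
    exact Filter.univ_mem' fun n => subset_closure ⟨hγ n,
      (hγR n).trans (ENNReal.ofReal_le_ofReal (he (mem_range_self n)))⟩)
  have hlim : Tendsto γ G (𝓝 γ') := hγ'
  have hfst := ProbabilityMeasure.tendsto_map_of_tendsto_of_continuous γ γ' hlim continuous_fst
  have hsnd := ProbabilityMeasure.tendsto_map_of_tendsto_of_continuous γ γ' hlim continuous_snd
  refine ⟨ge_of_tendsto' hw2 hw0, γ', ?_, ?_, ?_⟩
  · have hconst : ∀ n, (γ n).map continuous_fst.measurable.aemeasurable = μ := fun n =>
      Subtype.ext (hγ n)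
    simp only [hconst] at hfst
    exact (congrArg (fun x : ProbabilityMeasure α => (x : Measure α))
      (tendsto_nhds_unique hfst tendsto_const_nhds))
  · set U' : BoundedContinuousFunction (α × β) ℝ :=
      BoundedContinuousFunction.ofNormedAddCommGroup U hU M hM
    have := ProbabilityMeasure.tendsto_iff_forall_integral_tendsto.1 hlim U'
    exact le_of_tendsto_of_tendsto' this (hw1.mono_left hG) hγU
  · exact hφ.phiDivergence_le_of_tendsto _ hsnd (hw2.mono_left hG) hw0 hγR

end Compactness

/-! ### Weak duality and the multiplier -/

section Values

variable {α β : Type*} [MeasurableSpace α] [MeasurableSpace β] {U : α × β → ℝ}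
  {φ : ℝ≥0 → ℝ≥0∞} {ν₀ : ProbabilityMeasure β}

theorem penalizedObjective_le {γ : ProbabilityMeasure (α × β)} {θ e : ℝ} (hθ : 0 ≤ θ)
    (he : 0 ≤ e) (hγ : marginalDivergence φ ν₀ γ ≤ ENNReal.ofReal e) :
    penalizedObjective U φ ν₀ θ γ
      ≤ ((∫ p, U p ∂(γ : Measure (α × β)) + θ * e : ℝ) : EReal) := by
  rw [penalizedObjective, if_neg (ne_top_of_le_ne_top ENNReal.ofReal_ne_top hγ),
    EReal.coe_le_coe_iff]
  gcongr
  exact ENNReal.toReal_le_of_le_ofReal he hγ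

theorem coe_le_penalizedInner {μ : ProbabilityMeasure α} {x θ : ℝ}
    (h : ∀ z ∈ attainableBounds U φ ν₀ μ, x ≤ z.1 + θ * z.2) :
    (x : EReal) ≤ penalizedInner U φ ν₀ θ μ := by
  refine le_iInf₂ fun γ hγ => ?_
  rw [penalizedObjective]
  split_ifs with hR
  · exact le_top
  · exact EReal.coe_le_coe_iff.2 (h (_, _) ⟨ENNReal.toReal_nonneg, γ, hγ, le_rfl,
      (ENNReal.ofReal_toReal hR).ge⟩)

theorem constrainedInner_le_of_mem {μ : ProbabilityMeasure α} {x e : ℝ}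
    (h : (x, e) ∈ attainableBounds U φ ν₀ μ) :
    constrainedInner U φ ν₀ e μ ≤ (x : EReal) := by
  obtain ⟨-, γ, hγ, hU, hR⟩ := h
  exact (iInf₂_le γ ⟨hγ, hR⟩).trans (EReal.coe_le_coe_iff.2 hU)

theorem penalizedInner_sub_le_constrainedInner {μ : ProbabilityMeasure α} {θ e : ℝ} (hθ : 0 ≤ θ)
    (he : 0 ≤ e) :
    penalizedInner U φ ν₀ θ μ - ((θ * e : ℝ) : EReal) ≤ constrainedInner U φ ν₀ e μ := by
  refine le_iInf₂ fun γ hγ => ?_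
  refine EReal.sub_le_of_le_add ?_
  rw [← EReal.coe_add]
  exact (iInf₂_le γ hγ.1).trans (penalizedObjective_le hθ he hγ.2)

/-- Weak duality. -/
theorem penalizedValue_le_constrainedValue_add {Aμ : Set (ProbabilityMeasure α)} {θ e : ℝ}
    (hθ : 0 ≤ θ) (he : 0 ≤ e) :
    penalizedValue U φ ν₀ Aμ θ ≤ constrainedValue U φ ν₀ Aμ e + ((θ * e : ℝ) : EReal) := by
  refine iSup₂_le fun μ hμ => ?_
  rw [← EReal.sub_le_iff_le_add (Or.inl (EReal.coe_ne_bot _)) (Or.inl (EReal.coe_ne_top _))]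
  exact (penalizedInner_sub_le_constrainedInner hθ he).trans
    (le_iSup₂ (f := fun μ (_ : μ ∈ Aμ) => constrainedInner U φ ν₀ e μ) μ hμ)

/-- The product with `ν₀` has divergence exactly `φ 1`; this supplies the Slater point. -/
theorem exists_mem_attainableBounds_snd_eq
    (μ : ProbabilityMeasure α) {s : ℝ} (hs : φ 1 ≤ ENNReal.ofReal s) (hs0 : 0 ≤ s) :
    ∃ z ∈ attainableBounds U φ ν₀ μ, z.2 = s := by
  refine ⟨(_, s), ⟨hs0, μ.prod ν₀, ?_, le_rfl, ?_⟩, rfl⟩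
  · change ((μ : Measure α).prod (ν₀ : Measure β)).fst = μ
    simp
  · change phiDivergence φ ((μ : Measure α).prod (ν₀ : Measure β)).snd ν₀ ≤ _
    rw [Measure.snd_prod]
    simpa [phiDivergence_self] using hs

/-- The passage from the constrained to the penalized problem, with a multiplier given by
Slater's condition. -/
theorem IsEntropyFunction.exists_multiplier_of_isConstrainedOptimizer (hφ : IsEntropyFunction φ)
    (hU : Measurable U) {M : ℝ} (hM : ∀ p, |U p| ≤ M) {Aμ : Set (ProbabilityMeasure α)} {η : ℝ}
    (hη : φ 1 < ENNReal.ofReal η) {μ : ProbabilityMeasure α}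
    (hopt : ∃ γ, IsConstrainedOptimizer U φ ν₀ Aμ η μ γ) :
    ∃ θ : ℝ, 0 ≤ θ ∧
      (∀ γ, IsConstrainedOptimizer U φ ν₀ Aμ η μ γ → IsPenalizedOptimizer U φ ν₀ Aμ θ μ γ) ∧
      constrainedValue U φ ν₀ Aμ η = penalizedValue U φ ν₀ Aμ θ - ((θ * η : ℝ) : EReal) ∧
      IsGreatest
        ((fun t : ℝ => penalizedValue U φ ν₀ Aμ t - ((t * η : ℝ) : EReal)) '' Set.Ici 0)
        (constrainedValue U φ ν₀ Aμ η) := by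
  obtain ⟨γ₀, hμ, hγ₀, hγ₀v, hval⟩ := hopt
  set v := ∫ p, U p ∂(γ₀ : Measure (α × β)) with hv
  have hη0 : 0 < η := ENNReal.ofReal_pos.1 (zero_le.trans_lt hη)
  obtain ⟨θ, hθ, hmult⟩ := exists_multiplier_of_slater
    (convex_attainableBounds (ν₀ := ν₀) hφ hU hM μ) (v := v) (η := η) (by
      obtain ⟨z, hz, hzs⟩ := exists_mem_attainableBounds_snd_eq (U := U) (ν₀ := ν₀) μ
        (ENNReal.ofReal_toReal hη.ne_top).ge ENNReal.toReal_nonneg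
      refine ⟨z, hz, hzs ▸ ?_⟩
      exact (ENNReal.lt_ofReal_iff_toReal_lt hη.ne_top).1 hη)
    (fun z hz hzη => EReal.coe_le_coe_iff.1 (hγ₀v.trans_le
      (constrainedInner_le_of_mem (attainableBounds_upward z hz (z.1, η) le_rfl hzη))))
  -- These bounds close a cycle with weak duality, so the inner and outer penalized values both
  -- equal `v + θ * η`.
  have hle : ((v + θ * η : ℝ) : EReal) ≤ penalizedInner U φ ν₀ θ μ := coe_le_penalizedInner hmult
  have hle' : penalizedInner U φ ν₀ θ μ ≤ penalizedValue U φ ν₀ Aμ θ :=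
    le_iSup₂ (f := fun μ (_ : μ ∈ Aμ) => penalizedInner U φ ν₀ θ μ) μ hμ
  have hcv : constrainedValue U φ ν₀ Aμ η = v := (hγ₀v.trans hval).symm
  have hge : penalizedValue U φ ν₀ Aμ θ ≤ ((v + θ * η : ℝ) : EReal) := by
    refine (penalizedValue_le_constrainedValue_add hθ hη0.le).trans_eq ?_
    rw [hcv, EReal.coe_add]
  have hpv : penalizedValue U φ ν₀ Aμ θ = ((v + θ * η : ℝ) : EReal) :=
    le_antisymm hge (hle.trans hle')
  have hpi : penalizedInner U φ ν₀ θ μ = ((v + θ * η : ℝ) : EReal) :=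
    le_antisymm (hle'.trans hge) hle
  have hdual : constrainedValue U φ ν₀ Aμ η
      = penalizedValue U φ ν₀ Aμ θ - ((θ * η : ℝ) : EReal) := by
    rw [hcv, hpv, ← EReal.coe_sub, add_sub_cancel_right]
  refine ⟨θ, hθ, ?_, hdual, ⟨θ, hθ, hdual.symm⟩, ?_⟩
  · rintro γ ⟨-, hγ, hγv, -⟩
    refine ⟨hμ, hγ.1, le_antisymm ?_ (iInf₂_le γ hγ.1), hpi.trans hpv.symm⟩
    rw [hpi]
    have hγv' : ∫ p, U p ∂(γ : Measure (α × β)) = v :=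
      EReal.coe_injective (hγv.trans hγ₀v.symm)
    rw [← hγv']
    exact penalizedObjective_le hθ hη0.le hγ.2
  · rintro _ ⟨t, ht, rfl⟩
    exact EReal.sub_le_of_le_add (penalizedValue_le_constrainedValue_add ht hη0.le)

theorem neg_le_penalizedValue {M : ℝ} (hM : ∀ p, |U p| ≤ M) {Aμ : Set (ProbabilityMeasure α)}
    (hne : Aμ.Nonempty) {t : ℝ} (ht : 0 ≤ t) :
    ((-M : ℝ) : EReal) ≤ penalizedValue U φ ν₀ Aμ t := by
  obtain ⟨μ, hμ⟩ := hne
  refine le_trans (coe_le_penalizedInner fun z hz => ?_)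
    (le_iSup₂ (f := fun μ (_ : μ ∈ Aμ) => penalizedInner U φ ν₀ t μ) μ hμ)
  obtain ⟨h0, γ, -, hU, -⟩ := hz
  have := neg_le_integral hM γ
  have := mul_nonneg ht h0
  linarith

/-- The penalized value is bounded below by `-M` on the half-line, which a supporting line of
negative slope would violate far out. -/
theorem nonneg_of_mem_superdifferential {M : ℝ} (hM : ∀ p, |U p| ≤ M)
    {Aμ : Set (ProbabilityMeasure α)} {θ η : ℝ} (hθ : 0 ≤ θ)
    (hη : η ∈ superdifferential (penalizedValue U φ ν₀ Aμ) θ) : 0 ≤ η := by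
  obtain ⟨htop, hbot, hsup⟩ := hη
  have hne : Aμ.Nonempty := by
    rw [nonempty_iff_ne_empty]
    rintro rfl
    exact hbot (by simp [penalizedValue])
  lift penalizedValue U φ ν₀ Aμ θ to ℝ using ⟨htop, hbot⟩ with p hp
  by_contra! hneg
  obtain ⟨n, hn⟩ := exists_nat_gt ((p + M) / (-η))
  rw [div_lt_iff₀ (by linarith)] at hn
  have h1 := (neg_le_penalizedValue hM hne (by positivity)).trans (hsup (θ + n) (by positivity))
  rw [← EReal.coe_add, EReal.coe_le_coe_iff] at h1
  linarith

end Values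

/-! ### Strong duality at a supergradient -/

section StrongDuality

variable {α β : Type*} [MetricSpace α] [CompleteSpace α] [SecondCountableTopology α]
  [MeasurableSpace α] [BorelSpace α] [MetricSpace β] [CompleteSpace β]
  [SecondCountableTopology β] [MeasurableSpace β] [BorelSpace β]
  {U : α × β → ℝ} {φ : ℝ≥0 → ℝ≥0∞} {ν₀ : ProbabilityMeasure β}

/-- For a slope of the penalized value, the bound it predicts is attained at every decision. -/
theorem IsEntropyFunction.mem_attainableBounds_of_mem_superdifferential (hφ : IsEntropyFunction φ)
    (h : growthRate φ = ∞ ∨ CompactSpace (α × β)) (hU : Continuous U) {M : ℝ}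
    (hM : ∀ p, |U p| ≤ M) {Aμ : Set (ProbabilityMeasure α)} {θ η p : ℝ}
    (hp : penalizedValue U φ ν₀ Aμ θ = p)
    (hη : η ∈ superdifferential (penalizedValue U φ ν₀ Aμ) θ) {μ : ProbabilityMeasure α}
    (hμ : μ ∈ Aμ) : (p - θ * η, η) ∈ attainableBounds U φ ν₀ μ := by
  by_contra hnot
  obtain ⟨t, ht, B, hB, hmult⟩ := exists_multiplier_of_notMem
    (convex_attainableBounds hφ hU.measurable hM μ) (isClosed_attainableBounds hφ h hU hM μ)
    attainableBounds_upward (m := -M) (by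
      rintro z ⟨-, γ, -, hγ, -⟩
      exact (neg_le_integral hM γ).trans hγ) hnot
  -- The penalized value at `t` is at least `B + t * η`, strictly above the supporting line `p + η *
  -- (t - θ)`.
  have h1 := (coe_le_penalizedInner hmult).trans
    (le_iSup₂ (f := fun μ (_ : μ ∈ Aμ) => penalizedInner U φ ν₀ t μ) μ hμ)
  have h2 := h1.trans (hη.2.2 t ht)
  rw [hp, ← EReal.coe_add, EReal.coe_le_coe_iff] at h2
  linarith

theorem IsEntropyFunction.penalizedValue_eq_of_mem_superdifferential (hφ : IsEntropyFunction φ)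
    (h : growthRate φ = ∞ ∨ CompactSpace (α × β)) (hU : Continuous U) {M : ℝ}
    (hM : ∀ p, |U p| ≤ M) {Aμ : Set (ProbabilityMeasure α)} {θ η : ℝ} (hθ : 0 ≤ θ)
    (hη : η ∈ superdifferential (penalizedValue U φ ν₀ Aμ) θ) :
    penalizedValue U φ ν₀ Aμ θ = constrainedValue U φ ν₀ Aμ η + ((θ * η : ℝ) : EReal) := by
  have hη0 := nonneg_of_mem_superdifferential hM hθ hη
  refine le_antisymm (penalizedValue_le_constrainedValue_add hθ hη0) ?_
  obtain ⟨p, hp⟩ : ∃ p : ℝ, penalizedValue U φ ν₀ Aμ θ = p :=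
    ⟨_, (EReal.coe_toReal hη.1 hη.2.1).symm⟩
  have : constrainedValue U φ ν₀ Aμ η ≤ ((p - θ * η : ℝ) : EReal) := iSup₂_le fun μ hμ =>
    constrainedInner_le_of_mem
      (hφ.mem_attainableBounds_of_mem_superdifferential h hU hM hp hη hμ)
  refine (add_le_add_left this _).trans_eq ?_
  rw [hp, ← EReal.coe_add, sub_add_cancel]

/-- The passage from the penalized to the constrained problem. -/
theorem IsEntropyFunction.exists_isConstrainedOptimizer_of_isPenalizedOptimizer
    (hφ : IsEntropyFunction φ) (h : growthRate φ = ∞ ∨ CompactSpace (α × β)) (hU : Continuous U)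
    {M : ℝ} (hM : ∀ p, |U p| ≤ M) {Aμ : Set (ProbabilityMeasure α)} {θ η : ℝ} (hθ : 0 < θ)
    (hη : η ∈ superdifferential (penalizedValue U φ ν₀ Aμ) θ) {μ : ProbabilityMeasure α}
    (hμ : μ ∈ Aμ) (hopt : penalizedInner U φ ν₀ θ μ = penalizedValue U φ ν₀ Aμ θ) :
    ∃ γ, IsPenalizedOptimizer U φ ν₀ Aμ θ μ γ ∧ IsConstrainedOptimizer U φ ν₀ Aμ η μ γ ∧
      marginalDivergence φ ν₀ γ = ENNReal.ofReal η := by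
  have hη0 := nonneg_of_mem_superdifferential hM hθ.le hη
  obtain ⟨p, hp⟩ : ∃ p : ℝ, penalizedValue U φ ν₀ Aμ θ = p :=
    ⟨_, (EReal.coe_toReal hη.1 hη.2.1).symm⟩
  obtain ⟨-, γ, hγ, hγU, hγR⟩ :=
    hφ.mem_attainableBounds_of_mem_superdifferential h hU hM hp hη hμ
  dsimp only at hγU hγR
  have htop := ne_top_of_le_ne_top ENNReal.ofReal_ne_top hγR
  have hobj : penalizedObjective U φ ν₀ θ γ = ((∫ p, U p ∂(γ : Measure (α × β))
      + θ * (marginalDivergence φ ν₀ γ).toReal : ℝ) : EReal) := if_neg htop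
  have hle : penalizedInner U φ ν₀ θ μ ≤ penalizedObjective U φ ν₀ θ γ := iInf₂_le γ hγ
  have hle' := hle
  rw [hopt, hp, hobj, EReal.coe_le_coe_iff] at hle'
  have hR := ENNReal.toReal_le_of_le_ofReal hη0 hγR
  -- Smaller divergence, weighted by `θ > 0`, would push the objective below the optimal value `p`.
  have hRη : (marginalDivergence φ ν₀ γ).toReal = η := by
    refine le_antisymm hR ?_
    by_contra! hlt
    have := mul_lt_mul_of_pos_left hlt hθ
    linarith
  rw [hRη] at hle' hobj
  have hUeq : ∫ p, U p ∂(γ : Measure (α × β)) = p - θ * η := by linarith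
  have hcv : constrainedValue U φ ν₀ Aμ η = ((p - θ * η : ℝ) : EReal) := by
    have := hφ.penalizedValue_eq_of_mem_superdifferential h hU hM hθ.le hη
    rw [hp] at this
    rw [EReal.coe_sub, this, EReal.add_sub_cancel_right]
  have hci : constrainedInner U φ ν₀ η μ = ((p - θ * η : ℝ) : EReal) := by
    refine le_antisymm ((iInf₂_le γ ⟨hγ, hγR⟩).trans_eq (by rw [hUeq])) ?_
    have := penalizedInner_sub_le_constrainedInner (U := U) (φ := φ) (ν₀ := ν₀) (μ := μ) hθ.le hη0
    rwa [hopt, hp, ← EReal.coe_sub] at this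
  refine ⟨γ, ⟨hμ, hγ, ?_, hopt⟩, ⟨hμ, ⟨hγ, hγR⟩, ?_, hci.trans hcv.symm⟩, ?_⟩
  · rw [hobj, hopt, hp, hUeq, sub_add_cancel]
  · rw [hci, hUeq]
  · rw [← hRη, ENNReal.ofReal_toReal htop]

end StrongDuality

end RDRO

/-! ### Assembly of the two directions -/

theorem mainTheorem2 {n m : ℕ}
    (𝒳 : Set (EuclideanSpace ℝ (Fin n))) (h𝒳_closed : IsClosed 𝒳) (h𝒳_convex : Convex ℝ 𝒳)
    (𝒴 : Set (EuclideanSpace ℝ (Fin m))) (h𝒴_closed : IsClosed 𝒴) (h𝒴_convex : Convex ℝ 𝒴)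
    -- the probability space and the decision set
    {Ω : Type*} [MeasurableSpace Ω] (P : Measure Ω) [IsProbabilityMeasure P]
    (A : Set (Ω → 𝒳)) (hA_meas : ∀ X ∈ A, Measurable X)
    -- the entropy function and the nominal distribution
    (φ : ℝ≥0 → ℝ≥0∞) (hφ : RDRO.IsEntropyFunction φ) (ν₀ : ProbabilityMeasure 𝒴)
    -- the utility is continuous and bounded, and concave in the decision
    (U : 𝒳 × 𝒴 → ℝ) (hU_cont : Continuous U) (hU_bdd : ∃ M : ℝ, ∀ p, |U p| ≤ M)
    (hU_conc : RDRO.ConcaveInFst U)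
    -- the decision set is convex and its laws are weakly (sequentially) compact
    (hA_convex : RDRO.ConvexDecisions A)
    (hA_compact : IsSeqCompact (RDRO.decisionLaws P A))
    -- coercivity
    (h_coercive : RDRO.growthRate φ = ∞ ∨ ∀ a : ℝ, IsCompact {p : 𝒳 × 𝒴 | U p ≤ a})
    -- some metric on the joint laws makes every `Γ_μ` compact
    (hΓ_compact : ∃ d : MetricSpace (ProbabilityMeasure (𝒳 × 𝒴)),
      ∀ μ ∈ RDRO.decisionLaws P A,
        @IsCompact _ d.toUniformSpace.toTopologicalSpace (RDRO.couplings 𝒴 μ)) :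
    -- (1) from the constrained to the penalized problem; `θ` depends on `η` and `μ` only
    (∀ (η : ℝ), φ 1 < ENNReal.ofReal η → ∀ μ : ProbabilityMeasure 𝒳,
      (∃ γ, RDRO.IsConstrainedOptimizer U φ ν₀ (RDRO.decisionLaws P A) η μ γ) →
      ∃ θ : ℝ, 0 ≤ θ ∧
        (∀ γ, RDRO.IsConstrainedOptimizer U φ ν₀ (RDRO.decisionLaws P A) η μ γ →
          RDRO.IsPenalizedOptimizer U φ ν₀ (RDRO.decisionLaws P A) θ μ γ) ∧
        RDRO.constrainedValue U φ ν₀ (RDRO.decisionLaws P A) η =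
          RDRO.penalizedValue U φ ν₀ (RDRO.decisionLaws P A) θ - ((θ * η : ℝ) : EReal) ∧
        IsGreatest
          ((fun t : ℝ => RDRO.penalizedValue U φ ν₀ (RDRO.decisionLaws P A) t
            - ((t * η : ℝ) : EReal)) '' Set.Ici 0)
          (RDRO.constrainedValue U φ ν₀ (RDRO.decisionLaws P A) η)) ∧
    -- (2) from the penalized to the constrained problem
    (∀ θ : ℝ, 0 < θ →
      ((∃ μ γ, RDRO.IsPenalizedOptimizer U φ ν₀ (RDRO.decisionLaws P A) θ μ γ) →
        ∀ η ∈ RDRO.superdifferential (RDRO.penalizedValue U φ ν₀ (RDRO.decisionLaws P A)) θ,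
          ∃ μ γ, RDRO.IsPenalizedOptimizer U φ ν₀ (RDRO.decisionLaws P A) θ μ γ ∧
            RDRO.IsConstrainedOptimizer U φ ν₀ (RDRO.decisionLaws P A) η μ γ ∧
            0 ≤ η ∧ RDRO.marginalDivergence φ ν₀ γ = ENNReal.ofReal η) ∧
      ∀ η ∈ RDRO.superdifferential (RDRO.penalizedValue U φ ν₀ (RDRO.decisionLaws P A)) θ,
        RDRO.penalizedValue U φ ν₀ (RDRO.decisionLaws P A) θ =
          RDRO.constrainedValue U φ ν₀ (RDRO.decisionLaws P A) η + ((θ * η : ℝ) : EReal) ∧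
        IsLeast
          ((fun e : ℝ => RDRO.constrainedValue U φ ν₀ (RDRO.decisionLaws P A) e
            + ((θ * e : ℝ) : EReal)) '' Set.Ici 0)
          (RDRO.penalizedValue U φ ν₀ (RDRO.decisionLaws P A) θ)) := by
  obtain ⟨M, hM⟩ := hU_bdd
  have : CompleteSpace 𝒳 := h𝒳_closed.completeSpace_coe
  have : CompleteSpace 𝒴 := h𝒴_closed.completeSpace_coe
  -- As `U ≤ M`, the sublevel set at `M` is the whole product, so the second alternative amounts to
  -- compactness of the space.
  have h : RDRO.growthRate φ = ∞ ∨ CompactSpace (𝒳 × 𝒴) := h_coercive.imp_right fun hc =>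
    ⟨by
      have hall : {p : 𝒳 × 𝒴 | U p ≤ M} = Set.univ :=
        Set.eq_univ_of_forall fun p => (le_abs_self _).trans (hM p)
      exact hall ▸ hc M⟩
  refine ⟨fun η hη μ hopt =>
    hφ.exists_multiplier_of_isConstrainedOptimizer hU_cont.measurable hM hη hopt,
    fun θ hθ => ⟨?_, fun η hη => ?_⟩⟩
  · rintro ⟨μ, -, hμ, -, -, hopt⟩ η hη
    obtain ⟨γ, hγp, hγc, hγR⟩ :=
      hφ.exists_isConstrainedOptimizer_of_isPenalizedOptimizer h hU_cont hM hθ hη hμ hopt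
    exact ⟨μ, γ, hγp, hγc, RDRO.nonneg_of_mem_superdifferential hM hθ.le hη, hγR⟩
  · have hη0 := RDRO.nonneg_of_mem_superdifferential hM hθ.le hη
    have heq := hφ.penalizedValue_eq_of_mem_superdifferential h hU_cont hM hθ.le hη
    refine ⟨heq, ⟨η, hη0, heq.symm⟩, ?_⟩
    rintro _ ⟨e, he, rfl⟩
    exact RDRO.penalizedValue_le_constrainedValue_add hθ.le he
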